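/- **Language.** Fix countable sets of individual constants $k$, of $n$-ary predicate symbols $P$, and, for each $n\ge 1$, of $n$-ary relational constants $K$. There are countably infinitely many individual variables $x,y,\dots$ and individual parameters $a,\dots$, and for each $n\ge 1$ countably infinitely many $n$-ary relational variables $X,Y,\dots$ and parameters $A,\dots$. Terms are individual variables, parameters and constants. Formulas are built from $t_1=t_2$, $P(t_1,\dots,t_n)$, $U=V$, $U(t_1,\dots,t_n)$ (the atomic formulas; $U,V$ being $n$-ary relational variables, parameters or constants) by $\neg,\wedge,\vee,\to,\leftrightarrow$, $\forall x,\exists x,\forall X,\exists X$, and the formulas $(\lambda x\,\psi)t$, $(\lambda x\,\psi)\iota y\,\varphi$ and $(\lambda X\psi)\iota Y\varphi$ ($X,Y$ of the same arity), where $\lambda$ binds in $\psi$ only and $\iota$ in $\varphi$ only. A sequent $\Gamma\Rightarrow\Delta$ is a pair of finite multisets of formulas in which no variable occurs free (parameters play the role of free variables). A *name* is a parameter or a constant, individual or relational; $\varphi^x_b$, $\varphi^X_B$ denote substitution of a name for the free occurrences of a variable. **Semantics.** A general model $\mathfrak M$ consists of a set $D$, elements $I(k)\in D$, relations $I(P)\subseteq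 D^n$, and for each $n\ge1$ a set $G_n\subseteq\mathcal P(D^n)$ with $I(K)\in G_n$ for every $n$-ary $K$. An assignment $v$ maps individual variables and parameters into $D$ and $n$-ary relational variables and parameters into $G_n$. Satisfaction is as usual, with $\forall X,\exists X$ ranging over $G_n$, $U=V$ meaning equality of the values, $\mathfrak M,v\models(\lambda x\,\psi)t$ iff $\mathfrak M,v^x_{v(t)}\models\psi$, and $\mathfrak M,v\models(\lambda x\,\psi)\iota y\,\varphi$ iff there is $o\in D$ with $\mathfrak M,v^x_o\models\psi$, $\mathfrak M,v^y_o\models\varphi$, and $o'=o$ whenever $\mathfrak M,v^y_{o'}\models\varphi$; likewise for $(\lambda X\psi)\iota Y\varphi$ with $O\in G_n$. A sequent $\Gamma\Rightarrow\Delta$ holds in $\mathfrak M$ under $v$ if, whenever all formulas of $\Gamma$ are satisfied, some formula of $\Delta$ is. Write $\mathcal S\models H$ if for all $\mathfrak M$ and $v$: if every sequent of $\mathcal S$ holds in $\mathfrak M$ under $v$, so does $H$. Write $\mathcal S\models^{g}H$ if every $\mathfrak M$ in which all sequents of $\mathcal S$ hold under all assignments is one in which $H$ holds under all assignments. **Calculus.**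 The axioms are $\varphi\Rightarrow\varphi$. The rules are cut (from $\Gamma\Rightarrow\Delta,\varphi$ and $\varphi,\Pi\Rightarrow\Sigma$ infer $\Gamma,\Pi\Rightarrow\Delta,\Sigma$), weakening and contraction on both sides; the usual two-sided context-sharing rules for $\neg,\wedge,\vee,\to,\leftrightarrow$ (with $\wedge\Rightarrow$ and $\Rightarrow\vee$ in the form with both components in the premise); and the following, where $b,b_i,c$ and $B,C$ are arbitrary names and $a$, $A$ are parameters not occurring in the conclusion and different from $b$, $B$: * $\forall x\varphi,\Gamma\Rightarrow\Delta$ from $\varphi^x_b,\Gamma\Rightarrow\Delta$; $\Gamma\Rightarrow\Delta,\forall x\varphi$ from $\Gamma\Rightarrow\Delta,\varphi^x_a$; dually for $\exists x$; and the same rules for $\forall X,\exists X$ with $B$, $A$; * $\Gamma\Rightarrow\Delta$ from $b=b,\Gamma\Rightarrow\Delta$; and $b=c,\mathscr A^x_b,\Gamma\Rightarrow\Delta$ from $\mathscr A^x_c,\Gamma\Rightarrow\Delta$ with $\mathscr A$ atomic; * $(\lambda x\psi)b,\Gamma\Rightarrow\Delta$ from $\psi^x_b,\Gamma\Rightarrow\Delta$;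 $\Gamma\Rightarrow\Delta,(\lambda x\psi)b$ from $\Gamma\Rightarrow\Delta,\psi^x_b$; * $(\lambda x\psi)\iota y\varphi,\Gamma\Rightarrow\Delta$ from $\varphi^y_a,\psi^x_a,\Gamma\Rightarrow\Delta$; the same conclusion from $\Gamma\Rightarrow\Delta,\varphi^y_b$ and $\Gamma\Rightarrow\Delta,\varphi^y_c$ and $b=c,\Gamma\Rightarrow\Delta$; $\Gamma\Rightarrow\Delta,(\lambda x\psi)\iota y\varphi$ from $\Gamma\Rightarrow\Delta,\varphi^y_b$ and $\Gamma\Rightarrow\Delta,\psi^x_b$ and $\varphi^y_a,\Gamma\Rightarrow\Delta,a=b$; and the same three rules for $(\lambda X\psi)\iota Y\varphi$ with $A,B,C$; * $B=C,\Gamma\Rightarrow\Delta$ from $\Gamma\Rightarrow\Delta,B(\vec b),C(\vec b)$ and $B(\vec b),C(\vec b),\Gamma\Rightarrow\Delta$; $\Gamma\Rightarrow\Delta,B=C$ from $B(\vec a),\Gamma\Rightarrow\Delta,C(\vec a)$ and $C(\vec a),\Gamma\Rightarrow\Delta,B(\vec a)$, where $\vec a$ are distinct individual parameters not occurring in $\Gamma,\Delta$.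 Write $\mathcal S\vdash^{cf}H$ if there is a proof tree with root $H$ whose leaves are axioms or members of $\mathcal S$ and in which every cut formula is a formula of some sequent of $\mathcal S$. **Theorem (strong completeness).** Let $\mathcal S$ be a set of sequents and $H$ a sequent. If $\mathcal S\models H$, then $\mathcal S\vdash^{cf}H$. Moreover, if $\mathcal S$ is closed under simultaneous substitution of names for parameters (individual names for individual parameters, $n$-ary relational names for $n$-ary relational parameters), then already $\mathcal S\models^{g}H$ implies $\mathcal S\vdash^{cf}H$. -/

import Mathlib

namespace RLL

/-- The non-logical symbols: individual constants, `n`-ary predicate symbols, and, for each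
`n ≥ 1`, the `n`-ary relational constants. -/
structure Signature where
  Con : Type
  Pred : ℕ → Type
  RelCon : ℕ+ → Type

/-- Individual names: parameters (the free variables of the proof theory) and constants. -/
inductive Name (L : Signature) : Type
  | par (a : ℕ) : Name L
  | con (k : L.Con) : Name L

/-- Terms: individual variables, parameters and constants. -/
inductive Term (L : Signature) : Type
  | var (x : ℕ) : Term L
  | name (b : Name L) : Term L

/-- `n`-ary relational names: relational parameters and relational constants. -/
inductive RelName (L : Signature) (n : ℕ+) : Type
  | par (A : ℕ) : RelName L n
  | con (K : L.RelCon n) : RelName L n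

/-- `n`-ary relational variables, parameters and constants. -/
inductive RelTerm (L : Signature) (n : ℕ+) : Type
  | var (X : ℕ) : RelTerm L n
  | name (B : RelName L n) : RelTerm L n

/-- Formulas of the second-order language with `λ` and `ι`. -/
inductive Formula (L : Signature) : Type
  /-- `t = s` -/
  | eq (t s : Term L) : Formula L
  /-- `P(t₁, …, tₙ)` -/
  | pred {n : ℕ} (P : L.Pred n) (ts : Fin n → Term L) : Formula L
  /-- `X = Y` for relational `X`, `Y` of the same arity -/
  | relEq {n : ℕ+} (X Y : RelTerm L n) : Formula L
  /-- `X(t₁, …, tₙ)` -/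
  | rel {n : ℕ+} (X : RelTerm L n) (ts : Fin n → Term L) : Formula L
  | neg (φ : Formula L) : Formula L
  | and (φ ψ : Formula L) : Formula L
  | or (φ ψ : Formula L) : Formula L
  | imp (φ ψ : Formula L) : Formula L
  | iff (φ ψ : Formula L) : Formula L
  | all (x : ℕ) (φ : Formula L) : Formula L
  | ex (x : ℕ) (φ : Formula L) : Formula L
  /-- `(λx ψ) t` -/
  | lam (x : ℕ) (ψ : Formula L) (t : Term L) : Formula L
  /-- `(λx ψ) ιy φ`; here `λx` binds in `ψ` only and `ιy` binds in `φ` only -/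
  | lamIota (x : ℕ) (ψ : Formula L) (y : ℕ) (φ : Formula L) : Formula L
  /-- `∀X φ`, with `X` of arity `n` -/
  | all2 (n : ℕ+) (X : ℕ) (φ : Formula L) : Formula L
  /-- `∃X φ`, with `X` of arity `n` -/
  | ex2 (n : ℕ+) (X : ℕ) (φ : Formula L) : Formula L
  /-- `(λX ψ) ιY φ`, with `X` and `Y` of arity `n`; `λX` binds in `ψ` only, `ιY` in `φ` only -/
  | lamIota2 (n : ℕ+) (X : ℕ) (ψ : Formula L) (Y : ℕ) (φ : Formula L) : Formula L

variable {L : Signature}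

/-! ### Syntax: occurrences and substitution -/

/-- The individual variable `z` is the term `t`. -/
def Term.HasVar (z : ℕ) : Term L → Prop
  | .var x => x = z
  | .name _ => False

/-- The individual parameter `a` is the term `t`. -/
def Term.HasPar (a : ℕ) : Term L → Prop
  | .name (.par a') => a' = a
  | _ => False

/-- The `m`-ary relational variable `Z` is the given relational term. -/
def RelTerm.HasVar (m : ℕ+) (Z : ℕ) {n : ℕ+} : RelTerm L n → Prop
  | .var X => n = m ∧ X = Z
  | .name _ => False

/-- The `m`-ary relational parameter `A` is the given relational term. -/
def RelTerm.HasPar (m : ℕ+) (A : ℕ) {n : ℕ+} : RelTerm L n → Prop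
  | .name (.par A') => n = m ∧ A' = A
  | _ => False

/-- The term `t` with the variable `x` replaced by the name `b`. -/
def Term.subst (x : ℕ) (b : Name L) : Term L → Term L
  | .var y => if y = x then .name b else .var y
  | .name c => .name c

/-- A relational term with the `n`-ary relational variable `X` replaced by the name `B`. -/
def RelTerm.subst (n : ℕ+) (X : ℕ) (B : RelName L n) {m : ℕ+} : RelTerm L m → RelTerm L m
  | .var Y => if h : n = m then (if Y = X then .name (h ▸ B) else .var Y) else .var Y
  | .name C => .name C

namespace Formula

/-- The individual variable `z` occurs free in the formula. -/
def HasFree (z : ℕ) : Formula L → Prop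
  | eq t s => t.HasVar z ∨ s.HasVar z
  | pred _ ts => ∃ i, (ts i).HasVar z
  | relEq _ _ => False
  | rel _ ts => ∃ i, (ts i).HasVar z
  | neg φ => φ.HasFree z
  | and φ ψ => φ.HasFree z ∨ ψ.HasFree z
  | or φ ψ => φ.HasFree z ∨ ψ.HasFree z
  | imp φ ψ => φ.HasFree z ∨ ψ.HasFree z
  | iff φ ψ => φ.HasFree z ∨ ψ.HasFree z
  | all x φ => x ≠ z ∧ φ.HasFree z
  | ex x φ => x ≠ z ∧ φ.HasFree z
  | lam x ψ t => (x ≠ z ∧ ψ.HasFree z) ∨ t.HasVar z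
  | lamIota x ψ y φ => (x ≠ z ∧ ψ.HasFree z) ∨ (y ≠ z ∧ φ.HasFree z)
  | all2 _ _ φ => φ.HasFree z
  | ex2 _ _ φ => φ.HasFree z
  | lamIota2 _ _ ψ _ φ => ψ.HasFree z ∨ φ.HasFree z

/-- The `m`-ary relational variable `Z` occurs free in the formula. -/
def HasFreeRel (m : ℕ+) (Z : ℕ) : Formula L → Prop
  | eq _ _ => False
  | pred _ _ => False
  | relEq X Y => X.HasVar m Z ∨ Y.HasVar m Z
  | rel X _ => X.HasVar m Z
  | neg φ => φ.HasFreeRel m Z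
  | and φ ψ => φ.HasFreeRel m Z ∨ ψ.HasFreeRel m Z
  | or φ ψ => φ.HasFreeRel m Z ∨ ψ.HasFreeRel m Z
  | imp φ ψ => φ.HasFreeRel m Z ∨ ψ.HasFreeRel m Z
  | iff φ ψ => φ.HasFreeRel m Z ∨ ψ.HasFreeRel m Z
  | all _ φ => φ.HasFreeRel m Z
  | ex _ φ => φ.HasFreeRel m Z
  | lam _ ψ _ => ψ.HasFreeRel m Z
  | lamIota _ ψ _ φ => ψ.HasFreeRel m Z ∨ φ.HasFreeRel m Z
  | all2 n X φ => ¬ (n = m ∧ X = Z) ∧ φ.HasFreeRel m Z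
  | ex2 n X φ => ¬ (n = m ∧ X = Z) ∧ φ.HasFreeRel m Z
  | lamIota2 n X ψ Y φ =>
      (¬ (n = m ∧ X = Z) ∧ ψ.HasFreeRel m Z) ∨ (¬ (n = m ∧ Y = Z) ∧ φ.HasFreeRel m Z)

/-- No variable, individual or relational, occurs free: parameters are the only free symbols.
These are the formulas of the sequent calculus. -/
def Closed (φ : Formula L) : Prop :=
  (∀ z, ¬ φ.HasFree z) ∧ ∀ m Z, ¬ φ.HasFreeRel m Z

/-- The individual parameter `a` occurs in the formula. -/
def HasPar (a : ℕ) : Formula L → Prop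
  | eq t s => t.HasPar a ∨ s.HasPar a
  | pred _ ts => ∃ i, (ts i).HasPar a
  | relEq _ _ => False
  | rel _ ts => ∃ i, (ts i).HasPar a
  | neg φ => φ.HasPar a
  | and φ ψ => φ.HasPar a ∨ ψ.HasPar a
  | or φ ψ => φ.HasPar a ∨ ψ.HasPar a
  | imp φ ψ => φ.HasPar a ∨ ψ.HasPar a
  | iff φ ψ => φ.HasPar a ∨ ψ.HasPar a
  | all _ φ => φ.HasPar a
  | ex _ φ => φ.HasPar a
  | lam _ ψ t => ψ.HasPar a ∨ t.HasPar a
  | lamIota _ ψ _ φ => ψ.HasPar a ∨ φ.HasPar a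
  | all2 _ _ φ => φ.HasPar a
  | ex2 _ _ φ => φ.HasPar a
  | lamIota2 _ _ ψ _ φ => ψ.HasPar a ∨ φ.HasPar a

/-- The `m`-ary relational parameter `A` occurs in the formula. -/
def HasRelPar (m : ℕ+) (A : ℕ) : Formula L → Prop
  | eq _ _ => False
  | pred _ _ => False
  | relEq X Y => X.HasPar m A ∨ Y.HasPar m A
  | rel X _ => X.HasPar m A
  | neg φ => φ.HasRelPar m A
  | and φ ψ => φ.HasRelPar m A ∨ ψ.HasRelPar m A
  | or φ ψ => φ.HasRelPar m A ∨ ψ.HasRelPar m A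
  | imp φ ψ => φ.HasRelPar m A ∨ ψ.HasRelPar m A
  | iff φ ψ => φ.HasRelPar m A ∨ ψ.HasRelPar m A
  | all _ φ => φ.HasRelPar m A
  | ex _ φ => φ.HasRelPar m A
  | lam _ ψ _ => ψ.HasRelPar m A
  | lamIota _ ψ _ φ => ψ.HasRelPar m A ∨ φ.HasRelPar m A
  | all2 _ _ φ => φ.HasRelPar m A
  | ex2 _ _ φ => φ.HasRelPar m A
  | lamIota2 _ _ ψ _ φ => ψ.HasRelPar m A ∨ φ.HasRelPar m A

/-- Substitution of the name `b` for the free occurrences of the variable `x`. Names are never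
captured, so bound variables need no renaming. -/
def subst (x : ℕ) (b : Name L) : Formula L → Formula L
  | eq t s => eq (t.subst x b) (s.subst x b)
  | pred P ts => pred P fun i => (ts i).subst x b
  | relEq X Y => relEq X Y
  | rel X ts => rel X fun i => (ts i).subst x b
  | neg φ => neg (φ.subst x b)
  | and φ ψ => and (φ.subst x b) (ψ.subst x b)
  | or φ ψ => or (φ.subst x b) (ψ.subst x b)
  | imp φ ψ => imp (φ.subst x b) (ψ.subst x b)
  | iff φ ψ => iff (φ.subst x b) (ψ.subst x b)
  | all z φ => all z (if z = x then φ else φ.subst x b)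
  | ex z φ => ex z (if z = x then φ else φ.subst x b)
  | lam z ψ t => lam z (if z = x then ψ else ψ.subst x b) (t.subst x b)
  | lamIota z ψ y φ =>
      lamIota z (if z = x then ψ else ψ.subst x b) y (if y = x then φ else φ.subst x b)
  | all2 n X φ => all2 n X (φ.subst x b)
  | ex2 n X φ => ex2 n X (φ.subst x b)
  | lamIota2 n X ψ Y φ => lamIota2 n X (ψ.subst x b) Y (φ.subst x b)

/-- Substitution of the relational name `B` for the free occurrences of the `n`-ary relational
variable `X`. -/
def substRel (n : ℕ+) (X : ℕ) (B : RelName L n) : Formula L → Formula L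
  | eq t s => eq t s
  | pred P ts => pred P ts
  | relEq Y Z => relEq (Y.subst n X B) (Z.subst n X B)
  | rel Y ts => rel (Y.subst n X B) ts
  | neg φ => neg (φ.substRel n X B)
  | and φ ψ => and (φ.substRel n X B) (ψ.substRel n X B)
  | or φ ψ => or (φ.substRel n X B) (ψ.substRel n X B)
  | imp φ ψ => imp (φ.substRel n X B) (ψ.substRel n X B)
  | iff φ ψ => iff (φ.substRel n X B) (ψ.substRel n X B)
  | all z φ => all z (φ.substRel n X B)
  | ex z φ => ex z (φ.substRel n X B)
  | lam z ψ t => lam z (ψ.substRel n X B) t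
  | lamIota z ψ y φ => lamIota z (ψ.substRel n X B) y (φ.substRel n X B)
  | all2 m Z φ => all2 m Z (if m = n ∧ Z = X then φ else φ.substRel n X B)
  | ex2 m Z φ => ex2 m Z (if m = n ∧ Z = X then φ else φ.substRel n X B)
  | lamIota2 m Z ψ Y φ =>
      lamIota2 m Z (if m = n ∧ Z = X then ψ else ψ.substRel n X B)
        Y (if m = n ∧ Y = X then φ else φ.substRel n X B)

/-- Atomic formulas (lambda atoms are not among them). -/
def IsAtomic : Formula L → Prop
  | eq _ _ => True
  | pred _ _ => True
  | relEq _ _ => True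
  | rel _ _ => True
  | _ => False

end Formula

/-- A simultaneous substitution of names for the individual and relational parameters. -/
structure ParSubst (L : Signature) where
  ind : ℕ → Name L
  rel : (n : ℕ+) → ℕ → RelName L n

def Term.parSubst (σ : ParSubst L) : Term L → Term L
  | .name (.par a) => .name (σ.ind a)
  | t => t

def RelTerm.parSubst (σ : ParSubst L) {n : ℕ+} : RelTerm L n → RelTerm L n
  | .name (.par A) => .name (σ.rel n A)
  | X => X

def Formula.parSubst (σ : ParSubst L) : Formula L → Formula L
  | eq t s => eq (t.parSubst σ) (s.parSubst σ)
  | pred P ts => pred P fun i => (ts i).parSubst σ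
  | relEq X Y => relEq (X.parSubst σ) (Y.parSubst σ)
  | rel X ts => rel (X.parSubst σ) fun i => (ts i).parSubst σ
  | neg φ => neg (φ.parSubst σ)
  | and φ ψ => and (φ.parSubst σ) (ψ.parSubst σ)
  | or φ ψ => or (φ.parSubst σ) (ψ.parSubst σ)
  | imp φ ψ => imp (φ.parSubst σ) (ψ.parSubst σ)
  | iff φ ψ => iff (φ.parSubst σ) (ψ.parSubst σ)
  | all x φ => all x (φ.parSubst σ)
  | ex x φ => ex x (φ.parSubst σ)
  | lam x ψ t => lam x (ψ.parSubst σ) (t.parSubst σ)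
  | lamIota x ψ y φ => lamIota x (ψ.parSubst σ) y (φ.parSubst σ)
  | all2 n X φ => all2 n X (φ.parSubst σ)
  | ex2 n X φ => ex2 n X (φ.parSubst σ)
  | lamIota2 n X ψ Y φ => lamIota2 n X (ψ.parSubst σ) Y (φ.parSubst σ)

/-! ### Semantics: general models -/

/-- A general model: a domain `D` with an interpretation of the symbols, and for each arity
`n ≥ 1` a set `G n` of `n`-ary relations on `D`. Nothing is required of `G n` except that it
contains the interpretations of the `n`-ary relational constants. -/
structure GeneralModel (L : Signature) where
  D : Type
  con : L.Con → D
  pred : {n : ℕ} → L.Pred n → Set (Fin n → D)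
  G : (n : ℕ+) → Set (Set (Fin n → D))
  relCon : {n : ℕ+} → L.RelCon n → G n

/-- An assignment: variables and parameters take values in `D`, respectively in `G n`. -/
structure Assignment (M : GeneralModel L) where
  var : ℕ → M.D
  par : ℕ → M.D
  relVar : (n : ℕ+) → ℕ → M.G n
  relPar : (n : ℕ+) → ℕ → M.G n

namespace Assignment

variable {M : GeneralModel L}

/-- The `x`-variant of `v` with value `o` at `x`. -/
def update (v : Assignment M) (x : ℕ) (o : M.D) : Assignment M :=
  { v with var := Function.update v.var x o }

/-- The `X`-variant of `v` with value `O` at the `n`-ary relational variable `X`. -/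
def updateRel (v : Assignment M) (n : ℕ+) (X : ℕ) (O : M.G n) : Assignment M :=
  { v with relVar := Function.update v.relVar n (Function.update (v.relVar n) X O) }

/-- The value of a term. -/
def term (v : Assignment M) : Term L → M.D
  | .var x => v.var x
  | .name (.par a) => v.par a
  | .name (.con k) => M.con k

/-- The value of a relational term. -/
def relTerm (v : Assignment M) {n : ℕ+} : RelTerm L n → M.G n
  | .var X => v.relVar n X
  | .name (.par A) => v.relPar n A
  | .name (.con K) => M.relCon K

end Assignment

/-- Satisfaction of a formula in a general model under an assignment. -/
def Sat (M : GeneralModel L) : Assignment M → Formula L → Prop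
  | v, .eq t s => v.term t = v.term s
  | v, .pred P ts => (fun i => v.term (ts i)) ∈ M.pred P
  | v, .relEq X Y => v.relTerm X = v.relTerm Y
  | v, .rel X ts => (fun i => v.term (ts i)) ∈ (v.relTerm X).1
  | v, .neg φ => ¬ Sat M v φ
  | v, .and φ ψ => Sat M v φ ∧ Sat M v ψ
  | v, .or φ ψ => Sat M v φ ∨ Sat M v ψ
  | v, .imp φ ψ => Sat M v φ → Sat M v ψ
  | v, .iff φ ψ => (Sat M v φ ↔ Sat M v ψ)
  | v, .all x φ => ∀ o : M.D, Sat M (v.update x o) φ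
  | v, .ex x φ => ∃ o : M.D, Sat M (v.update x o) φ
  | v, .lam x ψ t => Sat M (v.update x (v.term t)) ψ
  | v, .lamIota x ψ y φ => ∃ o : M.D, Sat M (v.update x o) ψ ∧ Sat M (v.update y o) φ ∧
      ∀ o' : M.D, Sat M (v.update y o') φ → o' = o
  | v, .all2 n X φ => ∀ O : M.G n, Sat M (v.updateRel n X O) φ
  | v, .ex2 n X φ => ∃ O : M.G n, Sat M (v.updateRel n X O) φ
  | v, .lamIota2 n X ψ Y φ => ∃ O : M.G n, Sat M (v.updateRel n X O) ψ ∧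
      Sat M (v.updateRel n Y O) φ ∧ ∀ O' : M.G n, Sat M (v.updateRel n Y O') φ → O' = O

/-- A sequent `Γ ⇒ Δ`, with `Γ` and `Δ` finite multisets of formulas. -/
structure Sequent (L : Signature) where
  ant : Multiset (Formula L)
  suc : Multiset (Formula L)

namespace Sequent

/-- The formula `φ` belongs to the sequent. -/
def Has (H : Sequent L) (φ : Formula L) : Prop := φ ∈ H.ant ∨ φ ∈ H.suc

/-- All formulas of the sequent are closed, so that it is a sequent of the calculus. -/
def Closed (H : Sequent L) : Prop := ∀ φ, H.Has φ → φ.Closed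

/-- Substitution of names for parameters throughout a sequent. -/
def parSubst (σ : ParSubst L) (H : Sequent L) : Sequent L :=
  ⟨H.ant.map (Formula.parSubst σ), H.suc.map (Formula.parSubst σ)⟩

/-- The sequent holds in `M` under `v`: if `v` satisfies all formulas on the left, it satisfies
one on the right. -/
def Holds (M : GeneralModel L) (v : Assignment M) (H : Sequent L) : Prop :=
  (∀ φ ∈ H.ant, Sat M v φ) → ∃ ψ ∈ H.suc, Sat M v ψ

end Sequent

/-- `H` follows from `S`: for every general model `M` and every assignment `v`, if all sequents
of `S` hold in `M` under `v`, so does `H`. -/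
def Entails (S : Set (Sequent L)) (H : Sequent L) : Prop :=
  ∀ (M : GeneralModel L) (v : Assignment M), (∀ s ∈ S, s.Holds M v) → H.Holds M v

/-- Every general model of `S` is a model of `H`, where being a model of a sequent means that
the sequent holds under all assignments. -/
def EntailsGlobally (S : Set (Sequent L)) (H : Sequent L) : Prop :=
  ∀ M : GeneralModel L, (∀ s ∈ S, ∀ v : Assignment M, s.Holds M v) →
    ∀ v : Assignment M, H.Holds M v

/-- `S` contains, with each sequent, all its substitution instances. -/
def SubstClosed (S : Set (Sequent L)) : Prop :=
  ∀ s ∈ S, ∀ σ : ParSubst L, s.parSubst σ ∈ S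

/-! ### The sequent calculus -/

/-- The individual parameter `a` does not occur in `Γ`. -/
def Fresh (a : ℕ) (Γ : Multiset (Formula L)) : Prop := ∀ χ ∈ Γ, ¬ χ.HasPar a

/-- The `n`-ary relational parameter `A` does not occur in `Γ`. -/
def FreshRel (n : ℕ+) (A : ℕ) (Γ : Multiset (Formula L)) : Prop := ∀ χ ∈ Γ, ¬ χ.HasRelPar n A

/-- `Deriv S C Γ Δ`: there is a proof tree with root `Γ ⇒ Δ`, whose leaves are axioms or members
of `S`, and in which every cut is on a formula of `C`. The proof is built from formulas without
free variables; the side conditions `Closed` ensure this where the premises do not.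
Eigenvariables are parameters, `b`, `c`, `B`, `C` stand for arbitrary parameters or constants. -/
inductive Deriv (S : Set (Sequent L)) (C : Set (Formula L)) :
    Multiset (Formula L) → Multiset (Formula L) → Prop
  | hyp {H : Sequent L} (h : H ∈ S) : Deriv S C H.ant H.suc
  | ax {φ : Formula L} (h : φ.Closed) : Deriv S C {φ} {φ}
  | cut {Γ Δ Θ Λ : Multiset (Formula L)} {φ : Formula L} (hφ : φ ∈ C) :
      Deriv S C Γ (φ ::ₘ Δ) → Deriv S C (φ ::ₘ Θ) Λ → Deriv S C (Γ + Θ) (Δ + Λ)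
  | weakL {Γ Δ : Multiset (Formula L)} {φ : Formula L} (h : φ.Closed) :
      Deriv S C Γ Δ → Deriv S C (φ ::ₘ Γ) Δ
  | weakR {Γ Δ : Multiset (Formula L)} {φ : Formula L} (h : φ.Closed) :
      Deriv S C Γ Δ → Deriv S C Γ (φ ::ₘ Δ)
  | contrL {Γ Δ : Multiset (Formula L)} {φ : Formula L} :
      Deriv S C (φ ::ₘ φ ::ₘ Γ) Δ → Deriv S C (φ ::ₘ Γ) Δ
  | contrR {Γ Δ : Multiset (Formula L)} {φ : Formula L} :
      Deriv S C Γ (φ ::ₘ φ ::ₘ Δ) → Deriv S C Γ (φ ::ₘ Δ)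
  | andL {Γ Δ : Multiset (Formula L)} {φ ψ : Formula L} :
      Deriv S C (φ ::ₘ ψ ::ₘ Γ) Δ → Deriv S C (.and φ ψ ::ₘ Γ) Δ
  | andR {Γ Δ : Multiset (Formula L)} {φ ψ : Formula L} :
      Deriv S C Γ (φ ::ₘ Δ) → Deriv S C Γ (ψ ::ₘ Δ) → Deriv S C Γ (.and φ ψ ::ₘ Δ)
  | negL {Γ Δ : Multiset (Formula L)} {φ : Formula L} :
      Deriv S C Γ (φ ::ₘ Δ) → Deriv S C (.neg φ ::ₘ Γ) Δ
  | negR {Γ Δ : Multiset (Formula L)} {φ : Formula L} :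
      Deriv S C (φ ::ₘ Γ) Δ → Deriv S C Γ (.neg φ ::ₘ Δ)
  | orL {Γ Δ : Multiset (Formula L)} {φ ψ : Formula L} :
      Deriv S C (φ ::ₘ Γ) Δ → Deriv S C (ψ ::ₘ Γ) Δ → Deriv S C (.or φ ψ ::ₘ Γ) Δ
  | orR {Γ Δ : Multiset (Formula L)} {φ ψ : Formula L} :
      Deriv S C Γ (φ ::ₘ ψ ::ₘ Δ) → Deriv S C Γ (.or φ ψ ::ₘ Δ)
  | impL {Γ Δ : Multiset (Formula L)} {φ ψ : Formula L} :
      Deriv S C Γ (φ ::ₘ Δ) → Deriv S C (ψ ::ₘ Γ) Δ → Deriv S C (.imp φ ψ ::ₘ Γ) Δ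
  | impR {Γ Δ : Multiset (Formula L)} {φ ψ : Formula L} :
      Deriv S C (φ ::ₘ Γ) (ψ ::ₘ Δ) → Deriv S C Γ (.imp φ ψ ::ₘ Δ)
  | iffL {Γ Δ : Multiset (Formula L)} {φ ψ : Formula L} :
      Deriv S C Γ (φ ::ₘ ψ ::ₘ Δ) → Deriv S C (φ ::ₘ ψ ::ₘ Γ) Δ →
      Deriv S C (.iff φ ψ ::ₘ Γ) Δ
  | iffR {Γ Δ : Multiset (Formula L)} {φ ψ : Formula L} :
      Deriv S C (φ ::ₘ Γ) (ψ ::ₘ Δ) → Deriv S C (ψ ::ₘ Γ) (φ ::ₘ Δ) →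
      Deriv S C Γ (.iff φ ψ ::ₘ Δ)
  | allL {Γ Δ : Multiset (Formula L)} {x : ℕ} {φ : Formula L} (b : Name L) :
      Deriv S C (φ.subst x b ::ₘ Γ) Δ → Deriv S C (.all x φ ::ₘ Γ) Δ
  | allR {Γ Δ : Multiset (Formula L)} {x : ℕ} {φ : Formula L} (a : ℕ)
      (hΓ : Fresh a Γ) (hΔ : Fresh a Δ) (hφ : ¬ φ.HasPar a) :
      Deriv S C Γ (φ.subst x (.par a) ::ₘ Δ) → Deriv S C Γ (.all x φ ::ₘ Δ)
  | exL {Γ Δ : Multiset (Formula L)} {x : ℕ} {φ : Formula L} (a : ℕ)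
      (hΓ : Fresh a Γ) (hΔ : Fresh a Δ) (hφ : ¬ φ.HasPar a) :
      Deriv S C (φ.subst x (.par a) ::ₘ Γ) Δ → Deriv S C (.ex x φ ::ₘ Γ) Δ
  | exR {Γ Δ : Multiset (Formula L)} {x : ℕ} {φ : Formula L} (b : Name L) :
      Deriv S C Γ (φ.subst x b ::ₘ Δ) → Deriv S C Γ (.ex x φ ::ₘ Δ)
  | eqPlus {Γ Δ : Multiset (Formula L)} (b : Name L) :
      Deriv S C (.eq (.name b) (.name b) ::ₘ Γ) Δ → Deriv S C Γ Δ
  | eqMinus {Γ Δ : Multiset (Formula L)} {x : ℕ} {φ : Formula L} (b c : Name L)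
      (hφ : φ.IsAtomic) :
      Deriv S C (φ.subst x c ::ₘ Γ) Δ →
      Deriv S C (.eq (.name b) (.name c) ::ₘ φ.subst x b ::ₘ Γ) Δ
  | lamL {Γ Δ : Multiset (Formula L)} {x : ℕ} {ψ : Formula L} (b : Name L) :
      Deriv S C (ψ.subst x b ::ₘ Γ) Δ → Deriv S C (.lam x ψ (.name b) ::ₘ Γ) Δ
  | lamR {Γ Δ : Multiset (Formula L)} {x : ℕ} {ψ : Formula L} (b : Name L) :
      Deriv S C Γ (ψ.subst x b ::ₘ Δ) → Deriv S C Γ (.lam x ψ (.name b) ::ₘ Δ)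
  | iotaL₁ {Γ Δ : Multiset (Formula L)} {x y : ℕ} {φ ψ : Formula L} (a : ℕ)
      (hΓ : Fresh a Γ) (hΔ : Fresh a Δ) (hφ : ¬ φ.HasPar a) (hψ : ¬ ψ.HasPar a) :
      Deriv S C (φ.subst y (.par a) ::ₘ ψ.subst x (.par a) ::ₘ Γ) Δ →
      Deriv S C (.lamIota x ψ y φ ::ₘ Γ) Δ
  | iotaL₂ {Γ Δ : Multiset (Formula L)} {x y : ℕ} {φ ψ : Formula L} (b c : Name L)
      (h : (Formula.lamIota x ψ y φ).Closed) :
      Deriv S C Γ (φ.subst y b ::ₘ Δ) → Deriv S C Γ (φ.subst y c ::ₘ Δ) →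
      Deriv S C (.eq (.name b) (.name c) ::ₘ Γ) Δ →
      Deriv S C (.lamIota x ψ y φ ::ₘ Γ) Δ
  | iotaR {Γ Δ : Multiset (Formula L)} {x y : ℕ} {φ ψ : Formula L} (b : Name L) (a : ℕ)
      (hΓ : Fresh a Γ) (hΔ : Fresh a Δ) (hφ : ¬ φ.HasPar a) (hψ : ¬ ψ.HasPar a)
      (hb : b ≠ .par a) :
      Deriv S C Γ (φ.subst y b ::ₘ Δ) → Deriv S C Γ (ψ.subst x b ::ₘ Δ) →
      Deriv S C (φ.subst y (.par a) ::ₘ Γ) (.eq (.name (.par a)) (.name b) ::ₘ Δ) →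
      Deriv S C Γ (.lamIota x ψ y φ ::ₘ Δ)
  | relEqL {Γ Δ : Multiset (Formula L)} {n : ℕ+} {A B : RelName L n} (b : Fin n → Name L) :
      Deriv S C Γ (.rel (.name A) (fun i => .name (b i)) ::ₘ
        .rel (.name B) (fun i => .name (b i)) ::ₘ Δ) →
      Deriv S C (.rel (.name A) (fun i => .name (b i)) ::ₘ
        .rel (.name B) (fun i => .name (b i)) ::ₘ Γ) Δ →
      Deriv S C (.relEq (.name A) (.name B) ::ₘ Γ) Δ
  | relEqR {Γ Δ : Multiset (Formula L)} {n : ℕ+} {A B : RelName L n} (a : Fin n → ℕ)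
      (ha : Function.Injective a) (hΓ : ∀ i, Fresh (a i) Γ) (hΔ : ∀ i, Fresh (a i) Δ) :
      Deriv S C (.rel (.name A) (fun i => .name (.par (a i))) ::ₘ Γ)
        (.rel (.name B) (fun i => .name (.par (a i))) ::ₘ Δ) →
      Deriv S C (.rel (.name B) (fun i => .name (.par (a i))) ::ₘ Γ)
        (.rel (.name A) (fun i => .name (.par (a i))) ::ₘ Δ) →
      Deriv S C Γ (.relEq (.name A) (.name B) ::ₘ Δ)
  | all2L {Γ Δ : Multiset (Formula L)} {n : ℕ+} {X : ℕ} {φ : Formula L} (B : RelName L n) :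
      Deriv S C (φ.substRel n X B ::ₘ Γ) Δ → Deriv S C (.all2 n X φ ::ₘ Γ) Δ
  | all2R {Γ Δ : Multiset (Formula L)} {n : ℕ+} {X : ℕ} {φ : Formula L} (A : ℕ)
      (hΓ : FreshRel n A Γ) (hΔ : FreshRel n A Δ) (hφ : ¬ φ.HasRelPar n A) :
      Deriv S C Γ (φ.substRel n X (.par A) ::ₘ Δ) → Deriv S C Γ (.all2 n X φ ::ₘ Δ)
  | ex2L {Γ Δ : Multiset (Formula L)} {n : ℕ+} {X : ℕ} {φ : Formula L} (A : ℕ)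
      (hΓ : FreshRel n A Γ) (hΔ : FreshRel n A Δ) (hφ : ¬ φ.HasRelPar n A) :
      Deriv S C (φ.substRel n X (.par A) ::ₘ Γ) Δ → Deriv S C (.ex2 n X φ ::ₘ Γ) Δ
  | ex2R {Γ Δ : Multiset (Formula L)} {n : ℕ+} {X : ℕ} {φ : Formula L} (B : RelName L n) :
      Deriv S C Γ (φ.substRel n X B ::ₘ Δ) → Deriv S C Γ (.ex2 n X φ ::ₘ Δ)
  | iota2L₁ {Γ Δ : Multiset (Formula L)} {n : ℕ+} {X Y : ℕ} {φ ψ : Formula L} (A : ℕ)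
      (hΓ : FreshRel n A Γ) (hΔ : FreshRel n A Δ)
      (hφ : ¬ φ.HasRelPar n A) (hψ : ¬ ψ.HasRelPar n A) :
      Deriv S C (φ.substRel n Y (.par A) ::ₘ ψ.substRel n X (.par A) ::ₘ Γ) Δ →
      Deriv S C (.lamIota2 n X ψ Y φ ::ₘ Γ) Δ
  | iota2L₂ {Γ Δ : Multiset (Formula L)} {n : ℕ+} {X Y : ℕ} {φ ψ : Formula L}
      (B B' : RelName L n) (h : (Formula.lamIota2 n X ψ Y φ).Closed) :
      Deriv S C Γ (φ.substRel n Y B ::ₘ Δ) → Deriv S C Γ (φ.substRel n Y B' ::ₘ Δ) →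
      Deriv S C (.relEq (.name B) (.name B') ::ₘ Γ) Δ →
      Deriv S C (.lamIota2 n X ψ Y φ ::ₘ Γ) Δ
  | iota2R {Γ Δ : Multiset (Formula L)} {n : ℕ+} {X Y : ℕ} {φ ψ : Formula L}
      (B : RelName L n) (A : ℕ)
      (hΓ : FreshRel n A Γ) (hΔ : FreshRel n A Δ)
      (hφ : ¬ φ.HasRelPar n A) (hψ : ¬ ψ.HasRelPar n A) (hB : B ≠ .par A) :
      Deriv S C Γ (φ.substRel n Y B ::ₘ Δ) → Deriv S C Γ (ψ.substRel n X B ::ₘ Δ) →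
      Deriv S C (φ.substRel n Y (.par A) ::ₘ Γ) (.relEq (.name (.par A)) (.name B) ::ₘ Δ) →
      Deriv S C Γ (.lamIota2 n X ψ Y φ ::ₘ Δ)

/-- `H` is derivable from `S` with all cuts on formulas that belong to (some sequent of) `S`. -/
def DerivableCF (S : Set (Sequent L)) (H : Sequent L) : Prop :=
  Deriv S {φ | ∃ s ∈ S, s.Has φ} H.ant H.suc

end RLL

/-!
Call a closed underivable sequent a condition, and order conditions by inclusion. Read upwards, a
rule of the calculus says that a condition containing its conclusion can be extended by one of its
premises; for a rule with an eigenvariable some instance of the premise will do, because a condition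
is finite and leaves fresh parameters. As the language is countable, the Rasiowa–Sikorski lemma
yields an ideal of conditions containing `H` that decides every rule. The left and right formulas of
its members form sets `Γ` and `Δ` that are saturated under all the rules. This includes cuts on
the formulas of `S`, so each sequent of `S` has a left formula in `Δ` or a right formula in `Γ`.

The names modulo the equations in `Γ`, with the relations denoted by the relational names, form a
general model. Under an assignment that evaluates every parameter as itself, it satisfies `Γ` and
falsifies `Δ`, hence satisfies `S` and refutes `H`. Any other assignment in this model arises from
such an assignment by substituting names for parameters, so if `S` is closed under substitutions,
then `S` holds under all of them.
-/

namespace RLL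

variable {L : Signature}

/-! ### Countability of the language -/

instance [Countable L.Con] : Countable (Name L) :=
  Function.Surjective.countable (f := Sum.elim Name.par Name.con) fun
    | .par a => ⟨.inl a, rfl⟩
    | .con k => ⟨.inr k, rfl⟩

instance [Countable L.Con] : Countable (Term L) :=
  Function.Surjective.countable (f := Sum.elim Term.var Term.name) fun
    | .var x => ⟨.inl x, rfl⟩
    | .name b => ⟨.inr b, rfl⟩

instance (n : ℕ+) [Countable (L.RelCon n)] : Countable (RelName L n) :=
  Function.Surjective.countable (f := Sum.elim RelName.par RelName.con) fun
    | .par A => ⟨.inl A, rfl⟩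
    | .con K => ⟨.inr K, rfl⟩

instance (n : ℕ+) [Countable (L.RelCon n)] : Countable (RelTerm L n) :=
  Function.Surjective.countable (f := Sum.elim RelTerm.var RelTerm.name) fun
    | .var X => ⟨.inl X, rfl⟩
    | .name B => ⟨.inr B, rfl⟩

namespace Formula

theorem countable_isAtomic [Countable L.Con] [∀ n, Countable (L.Pred n)]
    [∀ n, Countable (L.RelCon n)] : {φ : Formula L | φ.IsAtomic}.Countable := by
  have h := (Set.countable_range fun p : Term L × Term L => eq p.1 p.2).union <|
    (Set.countable_range fun p : Σ n, L.Pred n × (Fin n → Term L) => pred p.2.1 p.2.2).union <|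
    (Set.countable_range fun p : Σ n, RelTerm L n × RelTerm L n => relEq p.2.1 p.2.2).union <|
    Set.countable_range fun p : Σ n : ℕ+, RelTerm L n × (Fin n → Term L) => rel p.2.1 p.2.2
  refine h.mono fun φ hφ => ?_
  cases φ with
  | eq t s => exact .inl ⟨(t, s), rfl⟩
  | pred P ts => exact .inr (.inl ⟨⟨_, P, ts⟩, rfl⟩)
  | relEq X Y => exact .inr (.inr (.inl ⟨⟨_, X, Y⟩, rfl⟩))
  | rel X ts => exact .inr (.inr (.inr ⟨⟨_, X, ts⟩, rfl⟩))
  | _ => exact hφ.elim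

/-- A Gödel number of a formula, relative to a coding `a` of the atomic formulas and a coding `e`
of the terms. -/
def code (a : Formula L → ℕ) (e : Term L → ℕ) : Formula L → ℕ
  | neg φ => Nat.pair 1 (φ.code a e)
  | and φ ψ => Nat.pair 2 (Nat.pair (φ.code a e) (ψ.code a e))
  | or φ ψ => Nat.pair 3 (Nat.pair (φ.code a e) (ψ.code a e))
  | imp φ ψ => Nat.pair 4 (Nat.pair (φ.code a e) (ψ.code a e))
  | iff φ ψ => Nat.pair 5 (Nat.pair (φ.code a e) (ψ.code a e))
  | all x φ => Nat.pair 6 (Nat.pair x (φ.code a e))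
  | ex x φ => Nat.pair 7 (Nat.pair x (φ.code a e))
  | lam x ψ t => Nat.pair 8 (Nat.pair x (Nat.pair (ψ.code a e) (e t)))
  | lamIota x ψ y φ => Nat.pair 9 (Nat.pair x (Nat.pair (ψ.code a e) (Nat.pair y (φ.code a e))))
  | all2 n X φ => Nat.pair 10 (Nat.pair n (Nat.pair X (φ.code a e)))
  | ex2 n X φ => Nat.pair 11 (Nat.pair n (Nat.pair X (φ.code a e)))
  | lamIota2 n X ψ Y φ =>
      Nat.pair 12 (Nat.pair n (Nat.pair X (Nat.pair (ψ.code a e) (Nat.pair Y (φ.code a e)))))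
  | φ => Nat.pair 0 (a φ)

theorem code_injective {a : Formula L → ℕ} {e : Term L → ℕ} (ha : Set.InjOn a {φ | φ.IsAtomic})
    (he : e.Injective) : (code a e).Injective := by
  intro φ
  induction φ with
  | eq | pred | relEq | rel =>
      intro χ h
      cases χ <;> simp only [code, Nat.pair_eq_pair] at h <;>
        first | exact ha (by trivial) (by trivial) h.2 | exact absurd h.1 (by decide)
  | _ =>
      intro χ h
      cases χ <;> simp only [code, Nat.pair_eq_pair, PNat.coe_inj] at h <;>
        grind [Function.Injective]

instance [Countable L.Con] [∀ n, Countable (L.Pred n)] [∀ n, Countable (L.RelCon n)] :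
    Countable (Formula L) := by
  obtain ⟨a, ha⟩ := Set.countable_iff_exists_injOn.1 (countable_isAtomic (L := L))
  obtain ⟨e, he⟩ := exists_injective_nat (Term L)
  exact (code_injective ha he).countable

end Formula

/-! ### Substitution -/

/-- The number of connectives and binders of a formula. -/
def Formula.size : Formula L → ℕ
  | .eq _ _ | .pred _ _ | .relEq _ _ | .rel _ _ => 0
  | .neg φ | .all _ φ | .ex _ φ | .lam _ φ _ | .all2 _ _ φ | .ex2 _ _ φ => φ.size + 1
  | .and φ ψ | .or φ ψ | .imp φ ψ | .iff φ ψ | .lamIota _ φ _ ψ | .lamIota2 _ _ φ _ ψ =>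
      φ.size + ψ.size + 1

theorem Term.hasVar_subst {x z : ℕ} {b : Name L} {t : Term L} :
    (t.subst x b).HasVar z ↔ z ≠ x ∧ t.HasVar z := by
  cases t <;> simp only [subst, HasVar] <;> grind [HasVar]

theorem RelTerm.hasVar_subst {n m k : ℕ+} {X Z : ℕ} {B : RelName L n} {U : RelTerm L k} :
    (U.subst n X B).HasVar m Z ↔ ¬ (n = m ∧ X = Z) ∧ U.HasVar m Z := by
  cases U <;> simp only [subst, HasVar] <;> grind [HasVar]

theorem Term.exists_name_of_forall_not_hasVar {t : Term L} (h : ∀ z, ¬ t.HasVar z) :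
    ∃ b, t = .name b := by
  cases t with
  | var x => exact (h x rfl).elim
  | name b => exact ⟨b, rfl⟩

theorem RelTerm.exists_name_of_forall_not_hasVar {n : ℕ+} {U : RelTerm L n}
    (h : ∀ m Z, ¬ U.HasVar m Z) : ∃ B, U = .name B := by
  cases U with
  | var X => exact (h n X ⟨rfl, rfl⟩).elim
  | name B => exact ⟨B, rfl⟩

namespace Formula

@[simp] theorem size_subst (x : ℕ) (b : Name L) (φ : Formula L) :
    (φ.subst x b).size = φ.size := by
  induction φ <;> simp only [subst, size] <;> grind

@[simp] theorem size_substRel (n : ℕ+) (X : ℕ) (B : RelName L n) (φ : Formula L) :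
    (φ.substRel n X B).size = φ.size := by
  induction φ <;> simp only [substRel, size] <;> grind

theorem hasFree_subst {x z : ℕ} {b : Name L} {φ : Formula L} :
    (φ.subst x b).HasFree z ↔ z ≠ x ∧ φ.HasFree z := by
  induction φ <;> simp only [subst, HasFree, Term.hasVar_subst] <;> grind

theorem hasFreeRel_subst {x : ℕ} {b : Name L} {m : ℕ+} {Z : ℕ} {φ : Formula L} :
    (φ.subst x b).HasFreeRel m Z ↔ φ.HasFreeRel m Z := by
  induction φ <;> simp only [subst, HasFreeRel] <;> grind

theorem hasFree_substRel {n : ℕ+} {X z : ℕ} {B : RelName L n} {φ : Formula L} :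
    (φ.substRel n X B).HasFree z ↔ φ.HasFree z := by
  induction φ <;> simp only [substRel, HasFree] <;> grind

theorem hasFreeRel_substRel {n m : ℕ+} {X Z : ℕ} {B : RelName L n} {φ : Formula L} :
    (φ.substRel n X B).HasFreeRel m Z ↔ ¬ (n = m ∧ X = Z) ∧ φ.HasFreeRel m Z := by
  induction φ <;> simp only [substRel, HasFreeRel, RelTerm.hasVar_subst] <;> grind

theorem closed_subst {x : ℕ} {b : Name L} {φ : Formula L} :
    (φ.subst x b).Closed ↔
      (∀ z, ¬ (x ≠ z ∧ φ.HasFree z)) ∧ ∀ m Z, ¬ φ.HasFreeRel m Z := by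
  simp only [Closed, hasFree_subst, hasFreeRel_subst, ne_comm]

theorem closed_substRel {n : ℕ+} {X : ℕ} {B : RelName L n} {φ : Formula L} :
    (φ.substRel n X B).Closed ↔
      (∀ z, ¬ φ.HasFree z) ∧ ∀ m Z, ¬ (¬ (n = m ∧ X = Z) ∧ φ.HasFreeRel m Z) := by
  simp only [Closed, hasFree_substRel, hasFreeRel_substRel]

theorem closed_neg {φ : Formula L} : (neg φ).Closed ↔ φ.Closed := Iff.rfl

theorem closed_and {φ ψ : Formula L} : (and φ ψ).Closed ↔ φ.Closed ∧ ψ.Closed := by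
  simp only [Closed, HasFree, HasFreeRel, not_or, forall_and]
  tauto

theorem closed_or {φ ψ : Formula L} : (or φ ψ).Closed ↔ φ.Closed ∧ ψ.Closed := closed_and

theorem closed_imp {φ ψ : Formula L} : (imp φ ψ).Closed ↔ φ.Closed ∧ ψ.Closed := closed_and

theorem closed_iff {φ ψ : Formula L} : (iff φ ψ).Closed ↔ φ.Closed ∧ ψ.Closed := closed_and

theorem Closed.of_all {x : ℕ} {φ : Formula L} (h : (all x φ).Closed) (b : Name L) :
    (φ.subst x b).Closed := closed_subst.2 h

theorem Closed.of_ex {x : ℕ} {φ : Formula L} (h : (ex x φ).Closed) (b : Name L) :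
    (φ.subst x b).Closed := closed_subst.2 h

theorem Closed.of_lam {x : ℕ} {ψ : Formula L} {t : Term L} (h : (lam x ψ t).Closed)
    (b : Name L) : (ψ.subst x b).Closed :=
  closed_subst.2 ⟨fun z hz => h.1 z (.inl hz), h.2⟩

theorem Closed.of_lamIota_left {x y : ℕ} {ψ φ : Formula L} (h : (lamIota x ψ y φ).Closed)
    (b : Name L) : (ψ.subst x b).Closed :=
  closed_subst.2 ⟨fun z hz => h.1 z (.inl hz), fun m Z hZ => h.2 m Z (.inl hZ)⟩

theorem Closed.of_lamIota_right {x y : ℕ} {ψ φ : Formula L} (h : (lamIota x ψ y φ).Closed)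
    (b : Name L) : (φ.subst y b).Closed :=
  closed_subst.2 ⟨fun z hz => h.1 z (.inr hz), fun m Z hZ => h.2 m Z (.inr hZ)⟩

theorem Closed.of_all2 {n : ℕ+} {X : ℕ} {φ : Formula L} (h : (all2 n X φ).Closed)
    (B : RelName L n) : (φ.substRel n X B).Closed := closed_substRel.2 h

theorem Closed.of_ex2 {n : ℕ+} {X : ℕ} {φ : Formula L} (h : (ex2 n X φ).Closed)
    (B : RelName L n) : (φ.substRel n X B).Closed := closed_substRel.2 h

theorem Closed.of_lamIota2_left {n : ℕ+} {X Y : ℕ} {ψ φ : Formula L}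
    (h : (lamIota2 n X ψ Y φ).Closed) (B : RelName L n) : (ψ.substRel n X B).Closed :=
  closed_substRel.2 ⟨fun z hz => h.1 z (.inl hz), fun m Z hZ => h.2 m Z (.inl hZ)⟩

theorem Closed.of_lamIota2_right {n : ℕ+} {X Y : ℕ} {ψ φ : Formula L}
    (h : (lamIota2 n X ψ Y φ).Closed) (B : RelName L n) : (φ.substRel n Y B).Closed :=
  closed_substRel.2 ⟨fun z hz => h.1 z (.inr hz), fun m Z hZ => h.2 m Z (.inr hZ)⟩

theorem closed_eq_name (b c : Name L) : (eq (.name b) (.name c)).Closed := by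
  simp [Closed, HasFree, HasFreeRel, Term.HasVar]

theorem closed_relEq_name {n : ℕ+} (A B : RelName L n) :
    (relEq (.name A) (.name B)).Closed := by
  simp [Closed, HasFree, HasFreeRel, RelTerm.HasVar]

theorem closed_rel_name {n : ℕ+} (A : RelName L n) (b : Fin n → Name L) :
    (rel (.name A) fun i => .name (b i)).Closed := by
  simp [Closed, HasFree, HasFreeRel, RelTerm.HasVar, Term.HasVar]

end Formula

/-! ### Fresh parameters -/

section Fresh

open Filter

theorem Term.finite_hasPar (t : Term L) : {a | t.HasPar a}.Finite := by
  rcases t with _ | ⟨a⟩ | _ <;> simp [HasPar]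

theorem RelTerm.finite_hasPar (m : ℕ+) {n : ℕ+} (U : RelTerm L n) :
    {A | U.HasPar m A}.Finite := by
  rcases U with _ | ⟨A⟩ | _
  · simp [HasPar]
  · exact (Set.finite_singleton A).subset fun A' h => h.2.symm
  · simp [HasPar]

theorem Formula.finite_hasPar (φ : Formula L) : {a | φ.HasPar a}.Finite := by
  induction φ with
  | pred P ts | rel X ts =>
      simpa only [HasPar, Set.ofPred_exists] using Set.finite_iUnion fun i => (ts i).finite_hasPar
  | _ => simp_all [HasPar, Set.ofPred_or, Term.finite_hasPar]

theorem Formula.finite_hasRelPar (m : ℕ+) (φ : Formula L) : {A | φ.HasRelPar m A}.Finite := by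
  induction φ <;> simp_all [HasRelPar, Set.ofPred_or, RelTerm.finite_hasPar]

theorem Name.eventually_ne_par (b : Name L) : ∀ᶠ a in cofinite, b ≠ .par a := by
  cases b with
  | par a' => exact (eventually_cofinite_ne a').mono fun a ha h => ha (Name.par.inj h).symm
  | con k => simp

theorem RelName.eventually_ne_par {n : ℕ+} (B : RelName L n) :
    ∀ᶠ A in cofinite, B ≠ .par A := by
  cases B with
  | par A' => exact (eventually_cofinite_ne A').mono fun A hA h => hA (RelName.par.inj h).symm
  | con K => simp

theorem eventually_fresh (Γ : Multiset (Formula L)) : ∀ᶠ a in cofinite, Fresh a Γ :=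
  (eventually_all_finite Γ.finite_toSet).2 fun χ _ => by
    simpa only [eventually_cofinite, not_not] using χ.finite_hasPar

theorem eventually_freshRel (n : ℕ+) (Γ : Multiset (Formula L)) :
    ∀ᶠ A in cofinite, FreshRel n A Γ :=
  (eventually_all_finite Γ.finite_toSet).2 fun χ _ => by
    simpa only [eventually_cofinite, not_not] using χ.finite_hasRelPar n

theorem exists_injective_of_eventually_cofinite {α : Type*} [Infinite α] {p : α → Prop}
    (h : ∀ᶠ a in cofinite, p a) (n : ℕ) : ∃ f : Fin n → α, f.Injective ∧ ∀ i, p (f i) := by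
  have e := (frequently_cofinite_iff_infinite.1 h.frequently).natEmbedding
  exact ⟨fun i => e i, fun i j hij => Fin.ext (e.injective (Subtype.ext hij)), fun i => (e i).2⟩

end Fresh

/-! ### Satisfaction under substitution -/

namespace Assignment

variable {M : GeneralModel L} (v : Assignment M)

@[simp] theorem term_name_update (x : ℕ) (o : M.D) (b : Name L) :
    (v.update x o).term (.name b) = v.term (.name b) := by cases b <;> rfl

@[simp] theorem relTerm_update (x : ℕ) (o : M.D) {n : ℕ+} (U : RelTerm L n) :
    (v.update x o).relTerm U = v.relTerm U := by rcases U with _ | _ | _ <;> rfl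

@[simp] theorem term_updateRel (n : ℕ+) (X : ℕ) (O : M.G n) (t : Term L) :
    (v.updateRel n X O).term t = v.term t := by rcases t with _ | _ | _ <;> rfl

@[simp] theorem relTerm_name_updateRel (n : ℕ+) (X : ℕ) (O : M.G n) {m : ℕ+} (B : RelName L m) :
    (v.updateRel n X O).relTerm (.name B) = v.relTerm (.name B) := by cases B <;> rfl

theorem updateRel_relVar (n : ℕ+) (X : ℕ) (O : M.G n) (m : ℕ+) (Y : ℕ) :
    (v.updateRel n X O).relVar m Y =
      if h : n = m then (if Y = X then h ▸ O else v.relVar m Y) else v.relVar m Y := by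
  by_cases h : n = m
  · subst h
    simp [updateRel, Function.update_apply]
  · simp [updateRel, Function.update_of_ne (Ne.symm h), h]

theorem update_update_self (x : ℕ) (o o' : M.D) :
    (v.update x o).update x o' = v.update x o' := by simp [update]

theorem update_update_comm {x y : ℕ} (h : y ≠ x) (o o' : M.D) :
    (v.update x o).update y o' = (v.update y o').update x o := by
  simp [update, Function.update_comm h]

theorem update_updateRel (x : ℕ) (o : M.D) (n : ℕ+) (X : ℕ) (O : M.G n) :
    (v.update x o).updateRel n X O = (v.updateRel n X O).update x o := rfl

theorem updateRel_updateRel_self (n : ℕ+) (X : ℕ) (O O' : M.G n) :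
    (v.updateRel n X O).updateRel n X O' = v.updateRel n X O' := by simp [updateRel]

theorem updateRel_updateRel_comm {n m : ℕ+} {X Y : ℕ} (h : ¬ (m = n ∧ Y = X)) (O : M.G n)
    (O' : M.G m) :
    (v.updateRel n X O).updateRel m Y O' = (v.updateRel m Y O').updateRel n X O := by
  suffices ((v.updateRel n X O).updateRel m Y O').relVar =
      ((v.updateRel m Y O').updateRel n X O).relVar by simpa [updateRel] using this
  funext k Z
  simp only [updateRel_relVar]
  grind

theorem term_subst (x : ℕ) (b : Name L) (t : Term L) :
    v.term (t.subst x b) = (v.update x (v.term (.name b))).term t := by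
  cases t with
  | var y => by_cases h : y = x <;> simp [Term.subst, term, update, h]
  | name c => simp [Term.subst]

theorem relTerm_subst (n : ℕ+) (X : ℕ) (B : RelName L n) {m : ℕ+} (U : RelTerm L m) :
    v.relTerm (U.subst n X B) = (v.updateRel n X (v.relTerm (.name B))).relTerm U := by
  cases U with
  | var Y =>
      simp only [RelTerm.subst, relTerm.eq_1, updateRel_relVar]
      split_ifs with h
      · subst h; rfl
      · rfl
      · rfl
  | name C => simp [RelTerm.subst]

/-- The assignment that evaluates a parameter as `v` evaluates the name substituted for it. -/
def comp (σ : ParSubst L) : Assignment M :=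
  { v with
    par := fun a => v.term (.name (σ.ind a))
    relPar := fun n A => v.relTerm (.name (σ.rel n A)) }

theorem term_parSubst (σ : ParSubst L) (t : Term L) :
    v.term (t.parSubst σ) = (v.comp σ).term t := by
  rcases t with _ | _ | _ <;> rfl

theorem relTerm_parSubst (σ : ParSubst L) {n : ℕ+} (U : RelTerm L n) :
    v.relTerm (U.parSubst σ) = (v.comp σ).relTerm U := by
  rcases U with _ | _ | _ <;> rfl

theorem comp_update (σ : ParSubst L) (x : ℕ) (o : M.D) :
    (v.update x o).comp σ = (v.comp σ).update x o := by
  simp only [comp, term_name_update, relTerm_update]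
  rfl

theorem comp_updateRel (σ : ParSubst L) (n : ℕ+) (X : ℕ) (O : M.G n) :
    (v.updateRel n X O).comp σ = (v.comp σ).updateRel n X O := by
  simp only [comp, term_updateRel, relTerm_name_updateRel]
  rfl

end Assignment

section Sat

variable {M : GeneralModel L}

open Assignment

theorem sat_subst (x : ℕ) (b : Name L) (φ : Formula L) (v : Assignment M) :
    Sat M v (φ.subst x b) ↔ Sat M (v.update x (v.term (.name b))) φ := by
  have under_binder {χ : Formula L} (ih : ∀ v : Assignment M, Sat M v (χ.subst x b) ↔
      Sat M (v.update x (v.term (.name b))) χ) (v : Assignment M) (z : ℕ) (o : M.D) :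
      Sat M (v.update z o) (if z = x then χ else χ.subst x b) ↔
        Sat M ((v.update x (v.term (.name b))).update z o) χ := by
    split_ifs with h
    · rw [h, update_update_self]
    · rw [ih, term_name_update, update_update_comm _ h]
  induction φ generalizing v with
  | eq | pred | relEq | rel => simp only [Formula.subst, Sat, term_subst, relTerm_update]
  | neg φ ih => simp only [Formula.subst, Sat, ih]
  | and φ ψ ih₁ ih₂ | or φ ψ ih₁ ih₂ | imp φ ψ ih₁ ih₂ | iff φ ψ ih₁ ih₂ =>
      simp only [Formula.subst, Sat, ih₁, ih₂]
  | all z φ ih | ex z φ ih => simp only [Formula.subst, Sat, under_binder ih]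
  | lam z ψ t ih => simp only [Formula.subst, Sat, under_binder ih, term_subst]
  | lamIota z ψ y φ ih₁ ih₂ =>
      simp only [Formula.subst, Sat, under_binder ih₁, under_binder ih₂]
  | all2 n X φ ih | ex2 n X φ ih =>
      simp only [Formula.subst, Sat, ih, term_updateRel, update_updateRel]
  | lamIota2 n X ψ Y φ ih₁ ih₂ =>
      simp only [Formula.subst, Sat, ih₁, ih₂, term_updateRel, update_updateRel]

theorem sat_substRel (n : ℕ+) (X : ℕ) (B : RelName L n) (φ : Formula L) (v : Assignment M) :
    Sat M v (φ.substRel n X B) ↔ Sat M (v.updateRel n X (v.relTerm (.name B))) φ := by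
  have under_binder {χ : Formula L} (ih : ∀ v : Assignment M, Sat M v (χ.substRel n X B) ↔
      Sat M (v.updateRel n X (v.relTerm (.name B))) χ) (v : Assignment M) (m : ℕ+) (Z : ℕ)
      (O : M.G m) : Sat M (v.updateRel m Z O) (if m = n ∧ Z = X then χ else χ.substRel n X B) ↔
        Sat M ((v.updateRel n X (v.relTerm (.name B))).updateRel m Z O) χ := by
    split_ifs with h
    · obtain ⟨rfl, rfl⟩ := h
      rw [updateRel_updateRel_self]
    · rw [ih, relTerm_name_updateRel, updateRel_updateRel_comm _ h]
  induction φ generalizing v with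
  | eq | pred | relEq | rel =>
      simp only [Formula.substRel, Sat, relTerm_subst, term_updateRel]
  | neg φ ih => simp only [Formula.substRel, Sat, ih]
  | and φ ψ ih₁ ih₂ | or φ ψ ih₁ ih₂ | imp φ ψ ih₁ ih₂ | iff φ ψ ih₁ ih₂ =>
      simp only [Formula.substRel, Sat, ih₁, ih₂]
  | all z φ ih | ex z φ ih =>
      simp only [Formula.substRel, Sat, ih, relTerm_update, update_updateRel]
  | lam z ψ t ih =>
      simp only [Formula.substRel, Sat, ih, relTerm_update, term_updateRel, update_updateRel]
  | lamIota z ψ y φ ih₁ ih₂ =>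
      simp only [Formula.substRel, Sat, ih₁, ih₂, relTerm_update, update_updateRel]
  | all2 m Z φ ih | ex2 m Z φ ih => simp only [Formula.substRel, Sat, under_binder ih]
  | lamIota2 m Z ψ Y φ ih₁ ih₂ =>
      simp only [Formula.substRel, Sat, under_binder ih₁, under_binder ih₂]

theorem sat_parSubst (σ : ParSubst L) (φ : Formula L) (v : Assignment M) :
    Sat M v (φ.parSubst σ) ↔ Sat M (v.comp σ) φ := by
  induction φ generalizing v <;>
    simp_all only [Formula.parSubst, Sat, term_parSubst, relTerm_parSubst, comp_update,
      comp_updateRel]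

theorem Sequent.holds_parSubst (σ : ParSubst L) (H : Sequent L) (v : Assignment M) :
    (H.parSubst σ).Holds M v ↔ H.Holds M (v.comp σ) := by
  simp [Holds, parSubst, sat_parSubst]

end Sat

/-! ### Sequents and structural rules -/

namespace Sequent

/-- Sequents are ordered by inclusion of their sides as sets, so that contracting a formula does
not make a sequent smaller. -/
instance : Preorder (Sequent L) where
  le T U := T.ant ⊆ U.ant ∧ T.suc ⊆ U.suc
  le_refl _ := ⟨Multiset.Subset.refl _, Multiset.Subset.refl _⟩
  le_trans _ _ _ h h' := ⟨Multiset.Subset.trans h.1 h'.1, Multiset.Subset.trans h.2 h'.2⟩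

instance : Zero (Sequent L) := ⟨⟨0, 0⟩⟩

instance : Add (Sequent L) := ⟨fun T U => ⟨T.ant + U.ant, T.suc + U.suc⟩⟩

/-- The sequent `φ ⇒`. -/
def ofAnt (φ : Formula L) : Sequent L := ⟨{φ}, 0⟩

/-- The sequent `⇒ φ`. -/
def ofSuc (φ : Formula L) : Sequent L := ⟨0, {φ}⟩

/-- The left side of the sequent is included in `Γ`, the right side in `Δ`. -/
def Within (T : Sequent L) (Γ Δ : Set (Formula L)) : Prop :=
  (∀ φ ∈ T.ant, φ ∈ Γ) ∧ ∀ φ ∈ T.suc, φ ∈ Δ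

/-- The sequent has a proof from `S` with cuts on formulas of `C`. -/
abbrev Derivable (S : Set (Sequent L)) (C : Set (Formula L)) (T : Sequent L) : Prop :=
  Deriv S C T.ant T.suc

variable {T U V : Sequent L} {φ : Formula L} {Γ Δ : Set (Formula L)}

@[simp] theorem ant_zero : (0 : Sequent L).ant = 0 := rfl

@[simp] theorem suc_zero : (0 : Sequent L).suc = 0 := rfl

@[simp] theorem ant_add : (T + U).ant = T.ant + U.ant := rfl

@[simp] theorem suc_add : (T + U).suc = T.suc + U.suc := rfl

@[simp] theorem ant_ofAnt : (ofAnt φ).ant = {φ} := rfl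

@[simp] theorem suc_ofAnt : (ofAnt φ).suc = 0 := rfl

@[simp] theorem ant_ofSuc : (ofSuc φ).ant = 0 := rfl

@[simp] theorem suc_ofSuc : (ofSuc φ).suc = {φ} := rfl

theorem le_add_left : T ≤ U + T :=
  ⟨Multiset.subset_of_le le_add_self, Multiset.subset_of_le le_add_self⟩

theorem le_add_right : T ≤ T + U :=
  ⟨Multiset.subset_of_le le_self_add, Multiset.subset_of_le le_self_add⟩

theorem add_le (hT : T ≤ V) (hU : U ≤ V) : T + U ≤ V :=
  ⟨fun _ h => (Multiset.mem_add.1 h).elim (@hT.1 _) (@hU.1 _),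
    fun _ h => (Multiset.mem_add.1 h).elim (@hT.2 _) (@hU.2 _)⟩

@[simp] theorem closed_add : (T + U).Closed ↔ T.Closed ∧ U.Closed := by
  simp only [Closed, Has, ant_add, suc_add, Multiset.mem_add]
  grind

@[simp] theorem closed_ofAnt : (ofAnt φ).Closed ↔ φ.Closed := by simp [Closed, Has]

@[simp] theorem closed_ofSuc : (ofSuc φ).Closed ↔ φ.Closed := by simp [Closed, Has]

@[simp] theorem within_zero : (0 : Sequent L).Within Γ Δ := by simp [Within]

@[simp] theorem within_add : (T + U).Within Γ Δ ↔ T.Within Γ Δ ∧ U.Within Γ Δ := by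
  simp only [Within, ant_add, suc_add, Multiset.mem_add]
  grind

@[simp] theorem within_ofAnt : (ofAnt φ).Within Γ Δ ↔ φ ∈ Γ := by simp [Within]

@[simp] theorem within_ofSuc : (ofSuc φ).Within Γ Δ ↔ φ ∈ Δ := by simp [Within]

instance [Countable (Formula L)] : Countable (Sequent L) :=
  Function.Surjective.countable (f := fun p : Multiset (Formula L) × Multiset (Formula L) =>
    Sequent.mk p.1 p.2) fun T => ⟨(T.ant, T.suc), rfl⟩

end Sequent

namespace Deriv

variable {S : Set (Sequent L)} {C : Set (Formula L)} {Γ Δ : Multiset (Formula L)}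

theorem weakening_left {Θ : Multiset (Formula L)} (hΘ : ∀ φ ∈ Θ, φ.Closed)
    (h : Deriv S C Γ Δ) : Deriv S C (Θ + Γ) Δ := by
  induction Θ using Multiset.induction_on with
  | empty => rwa [zero_add]
  | cons φ Θ ih =>
      rw [Multiset.forall_mem_cons] at hΘ
      rw [Multiset.cons_add]
      exact .weakL hΘ.1 (ih hΘ.2)

theorem weakening_right {Θ : Multiset (Formula L)} (hΘ : ∀ φ ∈ Θ, φ.Closed)
    (h : Deriv S C Γ Δ) : Deriv S C Γ (Θ + Δ) := by
  induction Θ using Multiset.induction_on with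
  | empty => rwa [zero_add]
  | cons φ Θ ih =>
      rw [Multiset.forall_mem_cons] at hΘ
      rw [Multiset.cons_add]
      exact .weakR hΘ.1 (ih hΘ.2)

theorem contraction_left {Θ : Multiset (Formula L)} (hΘ : Θ ⊆ Γ)
    (h : Deriv S C (Θ + Γ) Δ) : Deriv S C Γ Δ := by
  induction Θ using Multiset.induction_on with
  | empty => rwa [zero_add] at h
  | cons φ Θ ih =>
      obtain ⟨hφ, hΘ⟩ := Multiset.cons_subset.1 hΘ
      refine ih hΘ ?_
      obtain ⟨Γ', rfl⟩ := Multiset.exists_cons_of_mem hφ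
      rw [Multiset.cons_add, Multiset.add_cons] at h
      rw [Multiset.add_cons]
      exact .contrL h

theorem contraction_right {Θ : Multiset (Formula L)} (hΘ : Θ ⊆ Δ)
    (h : Deriv S C Γ (Θ + Δ)) : Deriv S C Γ Δ := by
  induction Θ using Multiset.induction_on with
  | empty => rwa [zero_add] at h
  | cons φ Θ ih =>
      obtain ⟨hφ, hΘ⟩ := Multiset.cons_subset.1 hΘ
      refine ih hΘ ?_
      obtain ⟨Δ', rfl⟩ := Multiset.exists_cons_of_mem hφ
      rw [Multiset.cons_add, Multiset.add_cons] at h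
      rw [Multiset.add_cons]
      exact .contrR h

theorem multicut_left {Θ : Multiset (Formula L)} (hC : ∀ φ ∈ Θ, φ ∈ C)
    (hΘ : ∀ φ ∈ Θ, Deriv S C Γ (φ ::ₘ Δ)) (h : Deriv S C (Θ + Γ) Δ) : Deriv S C Γ Δ := by
  induction Θ using Multiset.induction_on with
  | empty => rwa [zero_add] at h
  | cons φ Θ ih =>
      rw [Multiset.forall_mem_cons] at hC hΘ
      refine ih hC.2 hΘ.2 ?_
      have hcut : Deriv S C (Γ + (Θ + Γ)) (Δ + Δ) := .cut hC.1 hΘ.1 (by rwa [← Multiset.cons_add])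
      exact (hcut.contraction_left (Multiset.subset_of_le le_add_self)).contraction_right
        (Multiset.Subset.refl Δ)

theorem multicut_right {Θ : Multiset (Formula L)} (hC : ∀ φ ∈ Θ, φ ∈ C)
    (hΘ : ∀ φ ∈ Θ, Deriv S C (φ ::ₘ Γ) Δ) (h : Deriv S C Γ (Θ + Δ)) : Deriv S C Γ Δ := by
  induction Θ using Multiset.induction_on with
  | empty => rwa [zero_add] at h
  | cons φ Θ ih =>
      rw [Multiset.forall_mem_cons] at hC hΘ
      refine ih hC.2 hΘ.2 ?_
      have hcut : Deriv S C (Γ + Γ) (Θ + Δ + Δ) := .cut hC.1 (by rwa [← Multiset.cons_add]) hΘ.1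
      rw [add_comm (Θ + Δ)] at hcut
      exact (hcut.contraction_left (Multiset.Subset.refl Γ)).contraction_right
        (Multiset.subset_of_le le_add_self)

end Deriv

namespace Sequent.Derivable

variable {S : Set (Sequent L)} {C : Set (Formula L)} {T U s : Sequent L}

theorem weakening (h : T.Derivable S C) (hU : U.Closed) : (U + T).Derivable S C :=
  (h.weakening_left fun φ hφ => hU φ (.inl hφ)).weakening_right fun φ hφ => hU φ (.inr hφ)

theorem contraction (h : (T + U).Derivable S C) (hTU : T ≤ U) : U.Derivable S C :=
  (Deriv.contraction_left hTU.1 h).contraction_right hTU.2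

theorem mono (h : T.Derivable S C) (hTU : T ≤ U) (hU : U.Closed) : U.Derivable S C := by
  have h' := h.weakening hU
  rw [Derivable, ant_add, suc_add, add_comm U.ant, add_comm U.suc] at h'
  exact contraction (T := T) h' hTU

theorem of_hyp (hs : s ∈ S) (hsC : ∀ φ, s.Has φ → φ ∈ C) (hsc : s.Closed) (hT : T.Closed)
    (hant : ∀ φ ∈ s.ant, (ofSuc φ + T).Derivable S C)
    (hsuc : ∀ φ ∈ s.suc, (ofAnt φ + T).Derivable S C) : T.Derivable S C := by
  refine Deriv.multicut_left (fun φ hφ => hsC φ (.inl hφ))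
    (fun φ hφ => by simpa [Derivable] using hant φ hφ) ?_
  refine Deriv.multicut_right (Θ := s.suc) (fun φ hφ => hsC φ (.inr hφ)) (fun φ hφ => ?_) ?_
  · have h : Deriv S C (φ ::ₘ T.ant) T.suc := by simpa [Derivable] using hsuc φ hφ
    simpa using h.weakening_left (Θ := s.ant) fun χ hχ => hsc χ (.inl hχ)
  · exact mono (T := s) (U := s + T) (.hyp hs) le_add_right (closed_add.2 ⟨hsc, hT⟩)

end Sequent.Derivable

/-! ### Saturated pairs of sets of formulas -/

/-- The sequents `𝓟` are the premises of an admissible rule with conclusion `U`, with an arbitrary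
context `T` added to all of them. Infinitely many premises serve to encode eigenvariables: the
premises of `⇒ ∀`, for instance, are all `φ(a)`, of which only one with `a` fresh is used. Open
sequents in `𝓟` are ignored. -/
def Reduces (S : Set (Sequent L)) (C : Set (Formula L)) (U : Sequent L) (𝓟 : Set (Sequent L)) :
    Prop :=
  ∀ T : Sequent L, T.Closed → (∀ P ∈ 𝓟, P.Closed → (P + T).Derivable S C) → (U + T).Derivable S C

/-- A pair of sets of closed formulas is saturated with respect to the premise families `𝓕` if with
the conclusion of an admissible rule with premises in `𝓕` it contains one of the premises. -/
structure Saturated (S : Set (Sequent L)) (C : Set (Formula L)) (𝓕 : Set (Set (Sequent L)))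
    (Γ Δ : Set (Formula L)) : Prop where
  closed_ant {φ : Formula L} : φ ∈ Γ → φ.Closed
  closed_suc {φ : Formula L} : φ ∈ Δ → φ.Closed
  exists_premise {U : Sequent L} {𝓟 : Set (Sequent L)} :
    𝓟 ∈ 𝓕 → Reduces S C U 𝓟 → U.Within Γ Δ → ∃ P ∈ 𝓟, P.Within Γ Δ

/-- The underivable closed sequents, which serve as conditions for the construction of a saturated
pair. -/
abbrev Underivable (S : Set (Sequent L)) (C : Set (Formula L)) :=
  {T : Sequent L // T.Closed ∧ ¬ T.Derivable S C}

namespace Underivable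

variable {S : Set (Sequent L)} {C : Set (Formula L)} {𝓟 : Set (Sequent L)}

/-- The conditions that contain one of the sequents of `𝓟` or are incompatible with all of them. -/
def deciding (S : Set (Sequent L)) (C : Set (Formula L)) (𝓟 : Set (Sequent L)) :
    Set (Underivable S C) :=
  {p | (∃ P ∈ 𝓟, P ≤ p.1) ∨ ∀ P ∈ 𝓟, P.Closed → (P + p.1).Derivable S C}

theorem isCofinal_deciding : IsCofinal (deciding S C 𝓟) := by
  intro p
  by_cases h : ∀ P ∈ 𝓟, P.Closed → (P + p.1).Derivable S C
  · exact ⟨p, .inr h, le_rfl⟩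
  · push Not at h
    obtain ⟨P, hP, hPc, hd⟩ := h
    exact ⟨⟨P + p.1, Sequent.closed_add.2 ⟨hPc, p.2.1⟩, hd⟩,
      .inl ⟨P, hP, Sequent.le_add_right⟩, Sequent.le_add_left⟩

variable (J : Order.Ideal (Underivable S C))

/-- The formulas on the left of the conditions in an ideal. -/
def antUnion : Set (Formula L) := {φ | ∃ p ∈ J, φ ∈ p.1.ant}

/-- The formulas on the right of the conditions in an ideal. -/
def sucUnion : Set (Formula L) := {φ | ∃ p ∈ J, φ ∈ p.1.suc}

variable {J}

theorem within_of_le {T : Sequent L} {p : Underivable S C} (hp : p ∈ J) (hT : T ≤ p.1) :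
    T.Within (antUnion J) (sucUnion J) :=
  ⟨fun _ hφ => ⟨p, hp, hT.1 hφ⟩, fun _ hφ => ⟨p, hp, hT.2 hφ⟩⟩

theorem exists_le_of_within {T : Sequent L} (hT : T.Within (antUnion J) (sucUnion J)) :
    ∃ p ∈ J, T ≤ p.1 := by
  have : Nonempty J := J.nonempty.to_subtype
  have : IsDirectedOrder J := ⟨J.directed.directed_val⟩
  have hant : ∀ᶠ p : J in Filter.atTop, ∀ φ ∈ T.ant, φ ∈ p.1.1.ant :=
    (Filter.eventually_all_finite T.ant.finite_toSet).2 fun φ hφ => by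
      obtain ⟨p, hp, hφp⟩ := hT.1 φ hφ
      exact Filter.eventually_atTop.2 ⟨⟨p, hp⟩, fun q hq => hq.1 hφp⟩
  have hsuc : ∀ᶠ p : J in Filter.atTop, ∀ φ ∈ T.suc, φ ∈ p.1.1.suc :=
    (Filter.eventually_all_finite T.suc.finite_toSet).2 fun φ hφ => by
      obtain ⟨p, hp, hφp⟩ := hT.2 φ hφ
      exact Filter.eventually_atTop.2 ⟨⟨p, hp⟩, fun q hq => hq.2 hφp⟩
  obtain ⟨p, hp⟩ := (hant.and hsuc).exists
  exact ⟨p.1, p.2, hp⟩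

theorem exists_premise_within {U : Sequent L} {q : Underivable S C} (hqJ : q ∈ J)
    (hq : q ∈ deciding S C 𝓟) (hU : Reduces S C U 𝓟)
    (hUJ : U.Within (antUnion J) (sucUnion J)) :
    ∃ P ∈ 𝓟, P.Within (antUnion J) (sucUnion J) := by
  rcases hq with ⟨P, hP, hPq⟩ | hq
  · exact ⟨P, hP, within_of_le hqJ hPq⟩
  · obtain ⟨p, hpJ, hUp⟩ := exists_le_of_within hUJ
    obtain ⟨r, -, hpr, hqr⟩ := J.directed p hpJ q hqJ
    refine (r.2.2 (Sequent.Derivable.contraction (hU r r.2.1 fun P hP hPc => ?_)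
      (hUp.trans hpr))).elim
    have hqr : q.1 ≤ r.1 := hqr
    exact (hq P hP hPc).mono
      (Sequent.add_le Sequent.le_add_right (hqr.trans Sequent.le_add_left))
      (Sequent.closed_add.2 ⟨hPc, r.2.1⟩)

end Underivable

open Underivable in
/-- The Rasiowa–Sikorski lemma for the order of underivable sequents. -/
theorem exists_saturated {S : Set (Sequent L)} {C : Set (Formula L)} {𝓕 : Set (Set (Sequent L))}
    (h𝓕 : 𝓕.Countable) {H : Sequent L} (hH : H.Closed) (hd : ¬ H.Derivable S C) :
    ∃ Γ Δ : Set (Formula L), H.Within Γ Δ ∧ Saturated S C 𝓕 Γ Δ := by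
  have : Countable 𝓕 := h𝓕.to_subtype
  have : Encodable 𝓕 := Encodable.ofCountable 𝓕
  let p : Underivable S C := ⟨H, hH, hd⟩
  let D (𝓟 : 𝓕) : Order.Cofinal (Underivable S C) := ⟨deciding S C 𝓟, isCofinal_deciding⟩
  let J := Order.idealOfCofinals p D
  refine ⟨antUnion J, sucUnion J, within_of_le (Order.mem_idealOfCofinals p D) le_rfl, ?_, ?_, ?_⟩
  · rintro φ ⟨q, -, hφ⟩
    exact q.2.1 φ (.inl hφ)
  · rintro φ ⟨q, -, hφ⟩
    exact q.2.1 φ (.inr hφ)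
  · intro U 𝓟 h𝓟 hU hUJ
    obtain ⟨q, hq, hqJ⟩ := Order.cofinal_meets_idealOfCofinals p D ⟨𝓟, h𝓟⟩
    exact exists_premise_within hqJ hq hU hUJ

/-! ### Saturation under the rules of the calculus -/

/-- The sequent with the formulas `φ(b)` for the pairs `(φ, x)` in `l` on the left and in `r` on the
right, where `φ(b)` is the result of substituting the name `b` for `x`. -/
def Sequent.instantiate (l r : Multiset (Formula L × ℕ)) (b : Name L) : Sequent L :=
  ⟨l.map fun p => p.1.subst p.2 b, r.map fun p => p.1.subst p.2 b⟩

/-- The analogue of `Sequent.instantiate` for `n`-ary relational variables. -/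
def Sequent.instantiateRel (n : ℕ+) (l r : Multiset (Formula L × ℕ)) (B : RelName L n) :
    Sequent L :=
  ⟨l.map fun p => p.1.substRel n p.2 B, r.map fun p => p.1.substRel n p.2 B⟩

/-- The sequents `A(a₁, …, aₙ) ⇒ B(a₁, …, aₙ)` and `B(a₁, …, aₙ) ⇒ A(a₁, …, aₙ)` for individual
parameters `aᵢ`: the premises of the rule introducing `A = B` on the right. -/
def separations {n : ℕ+} (A B : RelName L n) : Set (Sequent L) :=
  ⋃ a : Fin n → ℕ,
    {.ofAnt (.rel (.name A) fun i => .name (.par (a i))) +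
        .ofSuc (.rel (.name B) fun i => .name (.par (a i))),
      .ofAnt (.rel (.name B) fun i => .name (.par (a i))) +
        .ofSuc (.rel (.name A) fun i => .name (.par (a i)))}

/-- The families of premises with eigenvariables. -/
inductive IsEigenFamily : Set (Sequent L) → Prop
  | empty : IsEigenFamily ∅
  | instances (l r : Multiset (Formula L × ℕ)) :
      IsEigenFamily (Set.range fun a => .instantiate l r (.par a))
  | relInstances (n : ℕ+) (l r : Multiset (Formula L × ℕ)) :
      IsEigenFamily (Set.range fun A => .instantiateRel n l r (.par A))
  | separations {n : ℕ+} (A B : RelName L n) : IsEigenFamily (separations A B)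

/-- The families of premises of the rules of the calculus: finitely many premises without
eigenvariables and all instances of at most one with eigenvariables. -/
def premiseFamilies (L : Signature) : Set (Set (Sequent L)) :=
  Set.image2 (· ∪ ·) {F | F.Finite} {E | IsEigenFamily E}

theorem countable_isEigenFamily [Countable (Formula L)] [∀ n, Countable (RelName L n)] :
    {E : Set (Sequent L) | IsEigenFamily E}.Countable := by
  let f : Option ((Multiset (Formula L × ℕ) × Multiset (Formula L × ℕ)) ⊕
      (ℕ+ × Multiset (Formula L × ℕ) × Multiset (Formula L × ℕ)) ⊕
      (Σ n, RelName L n × RelName L n)) → Set (Sequent L)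
    | none => ∅
    | some (.inl (l, r)) => Set.range fun a => .instantiate l r (.par a)
    | some (.inr (.inl (n, l, r))) => Set.range fun A => .instantiateRel n l r (.par A)
    | some (.inr (.inr ⟨_, A, B⟩)) => separations A B
  refine (Set.countable_range f).mono ?_
  rintro _ (_ | ⟨l, r⟩ | ⟨n, l, r⟩ | ⟨A, B⟩)
  · exact ⟨none, rfl⟩
  · exact ⟨some (.inl (l, r)), rfl⟩
  · exact ⟨some (.inr (.inl (n, l, r))), rfl⟩
  · exact ⟨some (.inr (.inr ⟨_, A, B⟩)), rfl⟩

theorem countable_premiseFamilies [Countable (Formula L)] [∀ n, Countable (RelName L n)] :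
    (premiseFamilies L).Countable :=
  Set.Countable.ofPred_finite.image2 countable_isEigenFamily _

namespace Saturated

open Formula Sequent Filter

variable {S : Set (Sequent L)} {C : Set (Formula L)} {Γ Δ : Set (Formula L)} {U : Sequent L}
  (h : Saturated S C (premiseFamilies L) Γ Δ)

include h

theorem exists_premise_of_finite {F : Set (Sequent L)} (hF : F.Finite) (hU : U.Within Γ Δ)
    (hred : Reduces S C U F) : ∃ P ∈ F, P.Within Γ Δ :=
  h.exists_premise ⟨F, hF, ∅, .empty, Set.union_empty F⟩ hred hU

theorem within_of_derivable {P : Sequent L} (hP : P.Closed) (hU : U.Within Γ Δ)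
    (hred : ∀ T : Sequent L, (P + T).Derivable S C → (U + T).Derivable S C) : P.Within Γ Δ := by
  obtain ⟨_, rfl, hPw⟩ := h.exists_premise_of_finite (Set.finite_singleton P) hU
    fun T _ hd => hred T (hd P rfl hP)
  exact hPw

theorem within_or_within_of_derivable {P Q : Sequent L} (hP : P.Closed) (hQ : Q.Closed)
    (hU : U.Within Γ Δ)
    (hred : ∀ T : Sequent L,
      (P + T).Derivable S C → (Q + T).Derivable S C → (U + T).Derivable S C) :
    P.Within Γ Δ ∨ Q.Within Γ Δ := by
  obtain ⟨_, rfl | rfl, hw⟩ := h.exists_premise_of_finite (Set.toFinite {P, Q}) hU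
    fun T _ hd => hred T (hd P (.inl rfl) hP) (hd Q (.inr rfl) hQ)
  · exact .inl hw
  · exact .inr hw

theorem exists_within_of_eventually_derivable {F : Set (Sequent L)} (hF : F.Finite)
    {E : ℕ → Sequent L} (hE : IsEigenFamily (Set.range E)) (hFc : ∀ P ∈ F, P.Closed)
    (hEc : ∀ a, (E a).Closed) (hU : U.Within Γ Δ)
    (hred : ∀ T : Sequent L, (∀ P ∈ F, (P + T).Derivable S C) →
      ∀ᶠ a in cofinite, (E a + T).Derivable S C → (U + T).Derivable S C) :
    (∃ P ∈ F, P.Within Γ Δ) ∨ ∃ a, (E a).Within Γ Δ := by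
  obtain ⟨_, hP | ⟨a, rfl⟩, hw⟩ := h.exists_premise ⟨F, hF, _, hE, rfl⟩ (fun T _ hd => by
    obtain ⟨a, ha⟩ := (hred T fun P hP => hd P (.inl hP) (hFc P hP)).exists
    exact ha (hd _ (.inr ⟨a, rfl⟩) (hEc a))) hU
  · exact .inl ⟨_, hP, hw⟩
  · exact .inr ⟨a, hw⟩

theorem exists_eigen_within {E : ℕ → Sequent L} (hE : IsEigenFamily (Set.range E))
    (hEc : ∀ a, (E a).Closed) (hU : U.Within Γ Δ)
    (hred : ∀ T : Sequent L,
      ∀ᶠ a in cofinite, (E a + T).Derivable S C → (U + T).Derivable S C) :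
    ∃ a, (E a).Within Γ Δ := by
  simpa using h.exists_within_of_eventually_derivable Set.finite_empty hE (by simp) hEc hU
    fun T _ => hred T

theorem notMem_suc {φ : Formula L} (hφ : φ ∈ Γ) : φ ∉ Δ := fun hφ' => by
  have hc := h.closed_ant hφ
  have hax : (ofAnt φ + ofSuc φ).Derivable S C := by simpa [Derivable] using Deriv.ax hc
  obtain ⟨P, hP, -⟩ := h.exists_premise_of_finite (U := ofAnt φ + ofSuc φ) Set.finite_empty
    (by simp [hφ, hφ']) fun T hT _ => hax.mono le_add_right (by simp [hc, hT])
  exact hP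

theorem exists_mem_of_hyp {s : Sequent L} (hs : s ∈ S) (hsc : s.Closed)
    (hC : ∀ φ, s.Has φ → φ ∈ C) : (∃ φ ∈ s.ant, φ ∈ Δ) ∨ ∃ φ ∈ s.suc, φ ∈ Γ := by
  obtain ⟨_, ⟨φ, hφ, rfl⟩ | ⟨φ, hφ, rfl⟩, hw⟩ := h.exists_premise_of_finite (U := 0)
    (F := ofSuc '' {φ | φ ∈ s.ant} ∪ ofAnt '' {φ | φ ∈ s.suc})
    ((s.ant.finite_toSet.image _).union (s.suc.finite_toSet.image _)) within_zero
    fun T hT hd => by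
      have h := Derivable.of_hyp hs hC hsc hT
        (fun φ hφ => hd _ (.inl ⟨φ, hφ, rfl⟩) (closed_ofSuc.2 (hsc φ (.inl hφ))))
        (fun φ hφ => hd _ (.inr ⟨φ, hφ, rfl⟩) (closed_ofAnt.2 (hsc φ (.inr hφ))))
      simpa [Derivable] using h
  · exact .inl ⟨φ, hφ, within_ofSuc.1 hw⟩
  · exact .inr ⟨φ, hφ, within_ofAnt.1 hw⟩

theorem neg_ant {φ : Formula L} (hm : neg φ ∈ Γ) : φ ∈ Δ := by
  simpa using h.within_of_derivable (P := ofSuc φ) (U := ofAnt (neg φ))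
    (by simpa [closed_neg] using h.closed_ant hm) (by simpa using hm)
    fun T => by simpa [Derivable] using @Deriv.negL _ S C T.ant T.suc φ

theorem neg_suc {φ : Formula L} (hm : neg φ ∈ Δ) : φ ∈ Γ := by
  simpa using h.within_of_derivable (P := ofAnt φ) (U := ofSuc (neg φ))
    (by simpa [closed_neg] using h.closed_suc hm) (by simpa using hm)
    fun T => by simpa [Derivable] using @Deriv.negR _ S C T.ant T.suc φ

theorem and_ant {φ ψ : Formula L} (hm : and φ ψ ∈ Γ) : φ ∈ Γ ∧ ψ ∈ Γ := by
  simpa using h.within_of_derivable (P := ofAnt φ + ofAnt ψ) (U := ofAnt (and φ ψ))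
    (by simpa [closed_and] using h.closed_ant hm) (by simpa using hm)
    fun T => by simpa [Derivable] using @Deriv.andL _ S C T.ant T.suc φ ψ

theorem and_suc {φ ψ : Formula L} (hm : and φ ψ ∈ Δ) : φ ∈ Δ ∨ ψ ∈ Δ := by
  have hc := closed_and.1 (h.closed_suc hm)
  simpa using h.within_or_within_of_derivable (P := ofSuc φ) (Q := ofSuc ψ)
    (U := ofSuc (and φ ψ)) (by simpa using hc.1) (by simpa using hc.2) (by simpa using hm)
    fun T => by simpa [Derivable] using @Deriv.andR _ S C T.ant T.suc φ ψ

theorem or_ant {φ ψ : Formula L} (hm : or φ ψ ∈ Γ) : φ ∈ Γ ∨ ψ ∈ Γ := by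
  have hc := closed_or.1 (h.closed_ant hm)
  simpa using h.within_or_within_of_derivable (P := ofAnt φ) (Q := ofAnt ψ)
    (U := ofAnt (or φ ψ)) (by simpa using hc.1) (by simpa using hc.2) (by simpa using hm)
    fun T => by simpa [Derivable] using @Deriv.orL _ S C T.ant T.suc φ ψ

theorem or_suc {φ ψ : Formula L} (hm : or φ ψ ∈ Δ) : φ ∈ Δ ∧ ψ ∈ Δ := by
  simpa using h.within_of_derivable (P := ofSuc φ + ofSuc ψ) (U := ofSuc (or φ ψ))
    (by simpa [closed_or] using h.closed_suc hm) (by simpa using hm)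
    fun T => by simpa [Derivable] using @Deriv.orR _ S C T.ant T.suc φ ψ

theorem imp_ant {φ ψ : Formula L} (hm : imp φ ψ ∈ Γ) : φ ∈ Δ ∨ ψ ∈ Γ := by
  have hc := closed_imp.1 (h.closed_ant hm)
  simpa using h.within_or_within_of_derivable (P := ofSuc φ) (Q := ofAnt ψ)
    (U := ofAnt (imp φ ψ)) (by simpa using hc.1) (by simpa using hc.2) (by simpa using hm)
    fun T => by simpa [Derivable] using @Deriv.impL _ S C T.ant T.suc φ ψ

theorem imp_suc {φ ψ : Formula L} (hm : imp φ ψ ∈ Δ) : φ ∈ Γ ∧ ψ ∈ Δ := by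
  simpa using h.within_of_derivable (P := ofAnt φ + ofSuc ψ) (U := ofSuc (imp φ ψ))
    (by simpa [closed_imp] using h.closed_suc hm) (by simpa using hm)
    fun T => by simpa [Derivable] using @Deriv.impR _ S C T.ant T.suc φ ψ

theorem iff_ant {φ ψ : Formula L} (hm : Formula.iff φ ψ ∈ Γ) :
    (φ ∈ Δ ∧ ψ ∈ Δ) ∨ (φ ∈ Γ ∧ ψ ∈ Γ) := by
  have hc := closed_iff.1 (h.closed_ant hm)
  simpa using h.within_or_within_of_derivable (P := ofSuc φ + ofSuc ψ) (Q := ofAnt φ + ofAnt ψ)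
    (U := ofAnt (Formula.iff φ ψ)) (by simpa using hc) (by simpa using hc) (by simpa using hm)
    fun T => by simpa [Derivable] using @Deriv.iffL _ S C T.ant T.suc φ ψ

theorem iff_suc {φ ψ : Formula L} (hm : Formula.iff φ ψ ∈ Δ) :
    (φ ∈ Γ ∧ ψ ∈ Δ) ∨ (ψ ∈ Γ ∧ φ ∈ Δ) := by
  have hc := closed_iff.1 (h.closed_suc hm)
  simpa using h.within_or_within_of_derivable (P := ofAnt φ + ofSuc ψ) (Q := ofAnt ψ + ofSuc φ)
    (U := ofSuc (Formula.iff φ ψ)) (by simpa using hc) (by simpa using hc.symm) (by simpa using hm)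
    fun T => by simpa [Derivable] using @Deriv.iffR _ S C T.ant T.suc φ ψ

theorem all_ant {x : ℕ} {φ : Formula L} (hm : all x φ ∈ Γ) (b : Name L) : φ.subst x b ∈ Γ := by
  simpa using h.within_of_derivable (P := ofAnt (φ.subst x b)) (U := ofAnt (all x φ))
    (by simpa using (h.closed_ant hm).of_all b) (by simpa using hm)
    fun T => by simpa [Derivable] using @Deriv.allL _ S C T.ant T.suc x φ b

theorem all_suc {x : ℕ} {φ : Formula L} (hm : all x φ ∈ Δ) : ∃ b, φ.subst x b ∈ Δ := by
  obtain ⟨a, ha⟩ := h.exists_eigen_within (U := ofSuc (all x φ)) (.instances 0 {(φ, x)})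
    (fun a => by simpa [instantiate, Sequent.Closed, Has] using (h.closed_suc hm).of_all (.par a))
    (by simpa using hm) fun T => by
      filter_upwards [eventually_fresh T.ant, eventually_fresh T.suc,
        φ.finite_hasPar.eventually_cofinite_notMem] with a hΓ hΔ hφ
      simpa [Derivable, instantiate] using Deriv.allR (C := C) (S := S) a hΓ hΔ hφ
  exact ⟨.par a, by simpa [instantiate, Within] using ha⟩

theorem ex_ant {x : ℕ} {φ : Formula L} (hm : ex x φ ∈ Γ) : ∃ b, φ.subst x b ∈ Γ := by
  obtain ⟨a, ha⟩ := h.exists_eigen_within (U := ofAnt (ex x φ)) (.instances {(φ, x)} 0)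
    (fun a => by simpa [instantiate, Sequent.Closed, Has] using (h.closed_ant hm).of_ex (.par a))
    (by simpa using hm) fun T => by
      filter_upwards [eventually_fresh T.ant, eventually_fresh T.suc,
        φ.finite_hasPar.eventually_cofinite_notMem] with a hΓ hΔ hφ
      simpa [Derivable, instantiate] using Deriv.exL (C := C) (S := S) a hΓ hΔ hφ
  exact ⟨.par a, by simpa [instantiate, Within] using ha⟩

theorem ex_suc {x : ℕ} {φ : Formula L} (hm : ex x φ ∈ Δ) (b : Name L) : φ.subst x b ∈ Δ := by
  simpa using h.within_of_derivable (P := ofSuc (φ.subst x b)) (U := ofSuc (ex x φ))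
    (by simpa using (h.closed_suc hm).of_ex b) (by simpa using hm)
    fun T => by simpa [Derivable] using @Deriv.exR _ S C T.ant T.suc x φ b

theorem eq_refl (b : Name L) : eq (.name b) (.name b) ∈ Γ := by
  simpa using h.within_of_derivable (P := ofAnt (eq (.name b) (.name b))) (U := 0)
    (by simpa using closed_eq_name b b) within_zero
    fun T => by simpa [Derivable] using @Deriv.eqPlus _ S C T.ant T.suc b

theorem eq_subst {x : ℕ} {φ : Formula L} {b c : Name L} (hφ : φ.IsAtomic)
    (hbc : eq (.name b) (.name c) ∈ Γ) (hb : φ.subst x b ∈ Γ) : φ.subst x c ∈ Γ := by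
  simpa using h.within_of_derivable (P := ofAnt (φ.subst x c))
    (U := ofAnt (eq (.name b) (.name c)) + ofAnt (φ.subst x b))
    (by simpa [closed_subst] using h.closed_ant hb) (by simpa using ⟨hbc, hb⟩)
    fun T => by simpa [Derivable] using @Deriv.eqMinus _ S C T.ant T.suc x φ b c hφ

theorem lam_ant {x : ℕ} {ψ : Formula L} {b : Name L} (hm : lam x ψ (.name b) ∈ Γ) :
    ψ.subst x b ∈ Γ := by
  simpa using h.within_of_derivable (P := ofAnt (ψ.subst x b)) (U := ofAnt (lam x ψ (.name b)))
    (by simpa using (h.closed_ant hm).of_lam b) (by simpa using hm)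
    fun T => by simpa [Derivable] using @Deriv.lamL _ S C T.ant T.suc x ψ b

theorem lam_suc {x : ℕ} {ψ : Formula L} {b : Name L} (hm : lam x ψ (.name b) ∈ Δ) :
    ψ.subst x b ∈ Δ := by
  simpa using h.within_of_derivable (P := ofSuc (ψ.subst x b)) (U := ofSuc (lam x ψ (.name b)))
    (by simpa using (h.closed_suc hm).of_lam b) (by simpa using hm)
    fun T => by simpa [Derivable] using @Deriv.lamR _ S C T.ant T.suc x ψ b

theorem lamIota_ant {x y : ℕ} {ψ φ : Formula L} (hm : lamIota x ψ y φ ∈ Γ) :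
    ∃ b, φ.subst y b ∈ Γ ∧ ψ.subst x b ∈ Γ := by
  have hc := h.closed_ant hm
  obtain ⟨a, ha⟩ := h.exists_eigen_within (U := ofAnt (lamIota x ψ y φ))
    (.instances {(φ, y), (ψ, x)} 0)
    (fun a => by
      simpa [instantiate, Sequent.Closed, Has] using
        ⟨hc.of_lamIota_right (.par a), hc.of_lamIota_left (.par a)⟩)
    (by simpa using hm) fun T => by
      filter_upwards [eventually_fresh T.ant, eventually_fresh T.suc,
        φ.finite_hasPar.eventually_cofinite_notMem,
        ψ.finite_hasPar.eventually_cofinite_notMem] with a hΓ hΔ hφ hψ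
      simpa [Derivable, instantiate] using Deriv.iotaL₁ (C := C) (S := S) a hΓ hΔ hφ hψ
  exact ⟨.par a, by simpa [instantiate, Within] using ha⟩

theorem lamIota_ant_unique {x y : ℕ} {ψ φ : Formula L} (hm : lamIota x ψ y φ ∈ Γ)
    (b c : Name L) :
    φ.subst y b ∈ Δ ∨ φ.subst y c ∈ Δ ∨ eq (.name b) (.name c) ∈ Γ := by
  have hc := h.closed_ant hm
  have hw := h.exists_premise_of_finite (U := ofAnt (lamIota x ψ y φ))
    (F := {ofSuc (φ.subst y b), ofSuc (φ.subst y c), ofAnt (eq (.name b) (.name c))})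
    (Set.toFinite _) (by simpa using hm) fun T _ hd => by
      have hd : Deriv S C T.ant (φ.subst y b ::ₘ T.suc) ∧
          Deriv S C T.ant (φ.subst y c ::ₘ T.suc) ∧
            Deriv S C (eq (.name b) (.name c) ::ₘ T.ant) T.suc := by
        simpa [Derivable, hc.of_lamIota_right, closed_eq_name] using hd
      simpa [Derivable] using Deriv.iotaL₂ b c hc hd.1 hd.2.1 hd.2.2
  simpa using hw

theorem lamIota_suc {x y : ℕ} {ψ φ : Formula L} (hm : lamIota x ψ y φ ∈ Δ) (b : Name L) :
    φ.subst y b ∈ Δ ∨ ψ.subst x b ∈ Δ ∨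
      ∃ c, φ.subst y c ∈ Γ ∧ eq (.name c) (.name b) ∈ Δ := by
  have hc := h.closed_suc hm
  have hw := h.exists_within_of_eventually_derivable (U := ofSuc (lamIota x ψ y φ))
    (F := {ofSuc (φ.subst y b), ofSuc (ψ.subst x b)}) (Set.toFinite _)
    (.instances {(φ, y)} {(eq (.var 0) (.name b), 0)})
    (by simp [hc.of_lamIota_left, hc.of_lamIota_right])
    (fun a => by
      simpa [instantiate, Sequent.Closed, Has, Formula.subst, Term.subst] using
        ⟨hc.of_lamIota_right (.par a), closed_eq_name (.par a) b⟩)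
    (by simpa using hm) fun T hd => by
      have hd : Deriv S C T.ant (φ.subst y b ::ₘ T.suc) ∧
          Deriv S C T.ant (ψ.subst x b ::ₘ T.suc) := by
        simpa [Derivable] using hd
      filter_upwards [eventually_fresh T.ant, eventually_fresh T.suc,
        φ.finite_hasPar.eventually_cofinite_notMem, ψ.finite_hasPar.eventually_cofinite_notMem,
        b.eventually_ne_par] with a hΓ hΔ hφ hψ hab
      simpa [Derivable, instantiate, Formula.subst, Term.subst] using
        Deriv.iotaR b a hΓ hΔ hφ hψ hab hd.1 hd.2
  have hw : (φ.subst y b ∈ Δ ∨ ψ.subst x b ∈ Δ) ∨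
      ∃ a, φ.subst y (.par a) ∈ Γ ∧ eq (.name (.par a)) (.name b) ∈ Δ := by
    simpa [instantiate, Within, Formula.subst, Term.subst] using hw
  exact or_assoc.1 (hw.imp_right fun ⟨a, ha⟩ => ⟨.par a, ha⟩)

theorem relEq_ant {n : ℕ+} {A B : RelName L n} (hm : relEq (.name A) (.name B) ∈ Γ)
    (b : Fin n → Name L) :
    ((rel (.name A) fun i => .name (b i)) ∈ Δ ∧ (rel (.name B) fun i => .name (b i)) ∈ Δ) ∨
      ((rel (.name A) fun i => .name (b i)) ∈ Γ ∧ (rel (.name B) fun i => .name (b i)) ∈ Γ) := by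
  have hc := And.intro (closed_rel_name A b) (closed_rel_name B b)
  simpa using h.within_or_within_of_derivable (U := ofAnt (relEq (.name A) (.name B)))
    (P := ofSuc (rel (.name A) fun i => .name (b i)) + ofSuc (rel (.name B) fun i => .name (b i)))
    (Q := ofAnt (rel (.name A) fun i => .name (b i)) + ofAnt (rel (.name B) fun i => .name (b i)))
    (by simpa using hc) (by simpa using hc) (by simpa using hm)
    fun T => by simpa [Derivable] using @Deriv.relEqL _ S C T.ant T.suc n A B b

theorem relEq_suc {n : ℕ+} {A B : RelName L n} (hm : relEq (.name A) (.name B) ∈ Δ) :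
    ∃ b : Fin n → Name L,
      ((rel (.name A) fun i => .name (b i)) ∈ Γ ∧ (rel (.name B) fun i => .name (b i)) ∈ Δ) ∨
        ((rel (.name B) fun i => .name (b i)) ∈ Γ ∧ (rel (.name A) fun i => .name (b i)) ∈ Δ) := by
  obtain ⟨P, hP, hw⟩ := h.exists_premise (U := ofSuc (relEq (.name A) (.name B)))
    ⟨∅, Set.finite_empty, _, .separations A B, Set.empty_union _⟩
    (fun T _ hd => by
      obtain ⟨a, ha, hf⟩ := exists_injective_of_eventually_cofinite
        ((eventually_fresh T.ant).and (eventually_fresh T.suc)) n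
      have hAB := hd _ (Set.mem_iUnion.2 ⟨a, .inl rfl⟩) (by simp [closed_rel_name])
      have hBA := hd _ (Set.mem_iUnion.2 ⟨a, .inr rfl⟩) (by simp [closed_rel_name])
      simpa [Derivable] using Deriv.relEqR a ha (fun i => (hf i).1) (fun i => (hf i).2)
        (by simpa [Derivable] using hAB) (by simpa [Derivable] using hBA))
    (by simpa using hm)
  obtain ⟨a, rfl | rfl⟩ := Set.mem_iUnion.1 hP
  · exact ⟨fun i => .par (a i), .inl (by simpa using hw)⟩
  · exact ⟨fun i => .par (a i), .inr (by simpa using hw)⟩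

theorem all2_ant {n : ℕ+} {X : ℕ} {φ : Formula L} (hm : all2 n X φ ∈ Γ) (B : RelName L n) :
    φ.substRel n X B ∈ Γ := by
  simpa using h.within_of_derivable (P := ofAnt (φ.substRel n X B)) (U := ofAnt (all2 n X φ))
    (by simpa using (h.closed_ant hm).of_all2 B) (by simpa using hm)
    fun T => by simpa [Derivable] using @Deriv.all2L _ S C T.ant T.suc n X φ B

theorem all2_suc {n : ℕ+} {X : ℕ} {φ : Formula L} (hm : all2 n X φ ∈ Δ) :
    ∃ B, φ.substRel n X B ∈ Δ := by
  obtain ⟨A, hA⟩ := h.exists_eigen_within (U := ofSuc (all2 n X φ)) (.relInstances n 0 {(φ, X)})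
    (fun A => by
      simpa [instantiateRel, Sequent.Closed, Has] using (h.closed_suc hm).of_all2 (.par A))
    (by simpa using hm) fun T => by
      filter_upwards [eventually_freshRel n T.ant, eventually_freshRel n T.suc,
        (φ.finite_hasRelPar n).eventually_cofinite_notMem] with A hΓ hΔ hφ
      simpa [Derivable, instantiateRel] using Deriv.all2R (C := C) (S := S) A hΓ hΔ hφ
  exact ⟨.par A, by simpa [instantiateRel, Within] using hA⟩

theorem ex2_ant {n : ℕ+} {X : ℕ} {φ : Formula L} (hm : ex2 n X φ ∈ Γ) :
    ∃ B, φ.substRel n X B ∈ Γ := by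
  obtain ⟨A, hA⟩ := h.exists_eigen_within (U := ofAnt (ex2 n X φ)) (.relInstances n {(φ, X)} 0)
    (fun A => by
      simpa [instantiateRel, Sequent.Closed, Has] using (h.closed_ant hm).of_ex2 (.par A))
    (by simpa using hm) fun T => by
      filter_upwards [eventually_freshRel n T.ant, eventually_freshRel n T.suc,
        (φ.finite_hasRelPar n).eventually_cofinite_notMem] with A hΓ hΔ hφ
      simpa [Derivable, instantiateRel] using Deriv.ex2L (C := C) (S := S) A hΓ hΔ hφ
  exact ⟨.par A, by simpa [instantiateRel, Within] using hA⟩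

theorem ex2_suc {n : ℕ+} {X : ℕ} {φ : Formula L} (hm : ex2 n X φ ∈ Δ) (B : RelName L n) :
    φ.substRel n X B ∈ Δ := by
  simpa using h.within_of_derivable (P := ofSuc (φ.substRel n X B)) (U := ofSuc (ex2 n X φ))
    (by simpa using (h.closed_suc hm).of_ex2 B) (by simpa using hm)
    fun T => by simpa [Derivable] using @Deriv.ex2R _ S C T.ant T.suc n X φ B

theorem lamIota2_ant {n : ℕ+} {X Y : ℕ} {ψ φ : Formula L} (hm : lamIota2 n X ψ Y φ ∈ Γ) :
    ∃ B, φ.substRel n Y B ∈ Γ ∧ ψ.substRel n X B ∈ Γ := by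
  have hc := h.closed_ant hm
  obtain ⟨A, hA⟩ := h.exists_eigen_within (U := ofAnt (lamIota2 n X ψ Y φ))
    (.relInstances n {(φ, Y), (ψ, X)} 0)
    (fun A => by
      simpa [instantiateRel, Sequent.Closed, Has] using
        ⟨hc.of_lamIota2_right (.par A), hc.of_lamIota2_left (.par A)⟩)
    (by simpa using hm) fun T => by
      filter_upwards [eventually_freshRel n T.ant, eventually_freshRel n T.suc,
        (φ.finite_hasRelPar n).eventually_cofinite_notMem,
        (ψ.finite_hasRelPar n).eventually_cofinite_notMem] with A hΓ hΔ hφ hψ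
      simpa [Derivable, instantiateRel] using Deriv.iota2L₁ (C := C) (S := S) A hΓ hΔ hφ hψ
  exact ⟨.par A, by simpa [instantiateRel, Within] using hA⟩

theorem lamIota2_ant_unique {n : ℕ+} {X Y : ℕ} {ψ φ : Formula L}
    (hm : lamIota2 n X ψ Y φ ∈ Γ) (A B : RelName L n) :
    φ.substRel n Y A ∈ Δ ∨ φ.substRel n Y B ∈ Δ ∨ relEq (.name A) (.name B) ∈ Γ := by
  have hc := h.closed_ant hm
  have hw := h.exists_premise_of_finite (U := ofAnt (lamIota2 n X ψ Y φ))
    (F := {ofSuc (φ.substRel n Y A), ofSuc (φ.substRel n Y B), ofAnt (relEq (.name A) (.name B))})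
    (Set.toFinite _) (by simpa using hm) fun T _ hd => by
      have hd : Deriv S C T.ant (φ.substRel n Y A ::ₘ T.suc) ∧
          Deriv S C T.ant (φ.substRel n Y B ::ₘ T.suc) ∧
            Deriv S C (relEq (.name A) (.name B) ::ₘ T.ant) T.suc := by
        simpa [Derivable, hc.of_lamIota2_right, closed_relEq_name] using hd
      simpa [Derivable] using Deriv.iota2L₂ A B hc hd.1 hd.2.1 hd.2.2
  simpa using hw

theorem lamIota2_suc {n : ℕ+} {X Y : ℕ} {ψ φ : Formula L} (hm : lamIota2 n X ψ Y φ ∈ Δ)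
    (B : RelName L n) :
    φ.substRel n Y B ∈ Δ ∨ ψ.substRel n X B ∈ Δ ∨
      ∃ A, φ.substRel n Y A ∈ Γ ∧ relEq (.name A) (.name B) ∈ Δ := by
  have hc := h.closed_suc hm
  have hw := h.exists_within_of_eventually_derivable (U := ofSuc (lamIota2 n X ψ Y φ))
    (F := {ofSuc (φ.substRel n Y B), ofSuc (ψ.substRel n X B)}) (Set.toFinite _)
    (.relInstances n {(φ, Y)} {(relEq (.var 0) (.name B), 0)})
    (by simp [hc.of_lamIota2_left, hc.of_lamIota2_right])
    (fun A => by
      simpa [instantiateRel, Sequent.Closed, Has, Formula.substRel, RelTerm.subst] using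
        ⟨hc.of_lamIota2_right (.par A), closed_relEq_name (.par A) B⟩)
    (by simpa using hm) fun T hd => by
      have hd : Deriv S C T.ant (φ.substRel n Y B ::ₘ T.suc) ∧
          Deriv S C T.ant (ψ.substRel n X B ::ₘ T.suc) := by
        simpa [Derivable] using hd
      filter_upwards [eventually_freshRel n T.ant, eventually_freshRel n T.suc,
        (φ.finite_hasRelPar n).eventually_cofinite_notMem,
        (ψ.finite_hasRelPar n).eventually_cofinite_notMem,
        B.eventually_ne_par] with A hΓ hΔ hφ hψ hAB
      simpa [Derivable, instantiateRel, Formula.substRel, RelTerm.subst] using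
        Deriv.iota2R B A hΓ hΔ hφ hψ hAB hd.1 hd.2
  have hw : (φ.substRel n Y B ∈ Δ ∨ ψ.substRel n X B ∈ Δ) ∨
      ∃ A, φ.substRel n Y (.par A) ∈ Γ ∧ relEq (.name (.par A)) (.name B) ∈ Δ := by
    simpa [instantiateRel, Within, Formula.substRel, RelTerm.subst] using hw
  exact or_assoc.1 (hw.imp_right fun ⟨A, hA⟩ => ⟨.par A, hA⟩)

end Saturated

/-! ### The truth lemma -/

namespace Assignment

variable {M : GeneralModel L}

/-- Every individual and every relation of the model is the value of a name, so that quantifiers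
may be read substitutionally. -/
structure NamesAll (v : Assignment M) : Prop where
  name_surjective : Function.Surjective fun b => v.term (.name b)
  relName_surjective (n : ℕ+) : Function.Surjective fun B : RelName L n => v.relTerm (.name B)

/-- The assignment `v` satisfies `φ` if `φ ∈ Γ` and falsifies it if `φ ∈ Δ`. -/
structure AgreesAt (Γ Δ : Set (Formula L)) (v : Assignment M) (φ : Formula L) : Prop where
  sat : φ ∈ Γ → Sat M v φ
  not_sat : φ ∈ Δ → ¬ Sat M v φ

namespace NamesAll

variable {v : Assignment M} (hv : v.NamesAll)

include hv

theorem sat_all {x : ℕ} {φ : Formula L} : Sat M v (.all x φ) ↔ ∀ b, Sat M v (φ.subst x b) := by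
  simp only [Sat, sat_subst, hv.name_surjective.forall]

theorem sat_ex {x : ℕ} {φ : Formula L} : Sat M v (.ex x φ) ↔ ∃ b, Sat M v (φ.subst x b) := by
  simp only [Sat, sat_subst, hv.name_surjective.exists]

theorem sat_lamIota {x y : ℕ} {ψ φ : Formula L} :
    Sat M v (.lamIota x ψ y φ) ↔ ∃ b, Sat M v (ψ.subst x b) ∧ Sat M v (φ.subst y b) ∧
      ∀ c, Sat M v (φ.subst y c) → Sat M v (.eq (.name c) (.name b)) := by
  simp only [Sat, sat_subst, hv.name_surjective.exists, hv.name_surjective.forall]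

theorem sat_all2 {n : ℕ+} {X : ℕ} {φ : Formula L} :
    Sat M v (.all2 n X φ) ↔ ∀ B, Sat M v (φ.substRel n X B) := by
  simp only [Sat, sat_substRel, (hv.relName_surjective n).forall]

theorem sat_ex2 {n : ℕ+} {X : ℕ} {φ : Formula L} :
    Sat M v (.ex2 n X φ) ↔ ∃ B, Sat M v (φ.substRel n X B) := by
  simp only [Sat, sat_substRel, (hv.relName_surjective n).exists]

theorem sat_lamIota2 {n : ℕ+} {X Y : ℕ} {ψ φ : Formula L} :
    Sat M v (.lamIota2 n X ψ Y φ) ↔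
      ∃ B, Sat M v (ψ.substRel n X B) ∧ Sat M v (φ.substRel n Y B) ∧
        ∀ A, Sat M v (φ.substRel n Y A) → Sat M v (.relEq (.name A) (.name B)) := by
  simp only [Sat, sat_substRel, (hv.relName_surjective n).exists,
    (hv.relName_surjective n).forall]

end NamesAll

end Assignment

namespace Saturated

open Formula Assignment

variable {S : Set (Sequent L)} {C Γ Δ : Set (Formula L)} {M : GeneralModel L} {v : Assignment M}
  (h : Saturated S C (premiseFamilies L) Γ Δ)

include h

theorem agreesAt_of_closed {φ : Formula L} (hφ : φ.Closed → v.AgreesAt Γ Δ φ) :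
    v.AgreesAt Γ Δ φ :=
  ⟨fun hm => (hφ (h.closed_ant hm)).sat hm, fun hm => (hφ (h.closed_suc hm)).not_sat hm⟩

theorem agreesAt_neg {φ : Formula L} (hφ : v.AgreesAt Γ Δ φ) : v.AgreesAt Γ Δ (neg φ) :=
  ⟨fun hm => hφ.not_sat (h.neg_ant hm), fun hm hs => hs (hφ.sat (h.neg_suc hm))⟩

theorem agreesAt_and {φ ψ : Formula L} (hφ : v.AgreesAt Γ Δ φ) (hψ : v.AgreesAt Γ Δ ψ) :
    v.AgreesAt Γ Δ (and φ ψ) :=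
  ⟨fun hm => (h.and_ant hm).imp hφ.sat hψ.sat, fun hm hs =>
    (h.and_suc hm).elim (hφ.not_sat · hs.1) (hψ.not_sat · hs.2)⟩

theorem agreesAt_or {φ ψ : Formula L} (hφ : v.AgreesAt Γ Δ φ) (hψ : v.AgreesAt Γ Δ ψ) :
    v.AgreesAt Γ Δ (or φ ψ) :=
  ⟨fun hm => (h.or_ant hm).imp hφ.sat hψ.sat, fun hm hs =>
    hs.elim (hφ.not_sat (h.or_suc hm).1) (hψ.not_sat (h.or_suc hm).2)⟩

theorem agreesAt_imp {φ ψ : Formula L} (hφ : v.AgreesAt Γ Δ φ) (hψ : v.AgreesAt Γ Δ ψ) :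
    v.AgreesAt Γ Δ (imp φ ψ) :=
  ⟨fun hm hs => (h.imp_ant hm).elim (fun hm => (hφ.not_sat hm hs).elim) hψ.sat, fun hm hs =>
    hψ.not_sat (h.imp_suc hm).2 (hs (hφ.sat (h.imp_suc hm).1))⟩

theorem agreesAt_iff {φ ψ : Formula L} (hφ : v.AgreesAt Γ Δ φ) (hψ : v.AgreesAt Γ Δ ψ) :
    v.AgreesAt Γ Δ (Formula.iff φ ψ) := by
  refine ⟨fun hm => ?_, fun hm hs => ?_⟩
  · rcases h.iff_ant hm with ⟨h₁, h₂⟩ | ⟨h₁, h₂⟩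
    · exact iff_of_false (hφ.not_sat h₁) (hψ.not_sat h₂)
    · exact iff_of_true (hφ.sat h₁) (hψ.sat h₂)
  · rcases h.iff_suc hm with ⟨h₁, h₂⟩ | ⟨h₁, h₂⟩
    · exact hψ.not_sat h₂ (hs.1 (hφ.sat h₁))
    · exact hφ.not_sat h₂ (hs.2 (hψ.sat h₁))

theorem agreesAt_all (hv : v.NamesAll) {x : ℕ} {φ : Formula L}
    (hφ : ∀ b, v.AgreesAt Γ Δ (φ.subst x b)) : v.AgreesAt Γ Δ (all x φ) := by
  refine ⟨fun hm => hv.sat_all.2 fun b => (hφ b).sat (h.all_ant hm b), fun hm hs => ?_⟩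
  obtain ⟨b, hb⟩ := h.all_suc hm
  exact (hφ b).not_sat hb (hv.sat_all.1 hs b)

theorem agreesAt_ex (hv : v.NamesAll) {x : ℕ} {φ : Formula L}
    (hφ : ∀ b, v.AgreesAt Γ Δ (φ.subst x b)) : v.AgreesAt Γ Δ (ex x φ) := by
  refine ⟨fun hm => hv.sat_ex.2 ((h.ex_ant hm).imp fun b => (hφ b).sat), fun hm hs => ?_⟩
  obtain ⟨b, hb⟩ := hv.sat_ex.1 hs
  exact (hφ b).not_sat (h.ex_suc hm b) hb

theorem agreesAt_lam {x : ℕ} {ψ : Formula L} {t : Term L}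
    (hψ : ∀ b, v.AgreesAt Γ Δ (ψ.subst x b)) : v.AgreesAt Γ Δ (lam x ψ t) :=
  h.agreesAt_of_closed fun hc => by
    obtain ⟨b, rfl⟩ := Term.exists_name_of_forall_not_hasVar fun z hz => hc.1 z (.inr hz)
    have hsat : Sat M v (lam x ψ (.name b)) ↔ Sat M v (ψ.subst x b) := (sat_subst x b ψ v).symm
    exact ⟨fun hm => hsat.2 ((hψ b).sat (h.lam_ant hm)),
      fun hm hs => (hψ b).not_sat (h.lam_suc hm) (hsat.1 hs)⟩

theorem agreesAt_lamIota (hv : v.NamesAll) {x y : ℕ} {ψ φ : Formula L}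
    (hψ : ∀ b, v.AgreesAt Γ Δ (ψ.subst x b)) (hφ : ∀ b, v.AgreesAt Γ Δ (φ.subst y b))
    (heq : ∀ b c, v.AgreesAt Γ Δ (eq (.name b) (.name c))) :
    v.AgreesAt Γ Δ (lamIota x ψ y φ) := by
  refine ⟨fun hm => ?_, fun hm hs => ?_⟩
  · obtain ⟨b, hφb, hψb⟩ := h.lamIota_ant hm
    refine hv.sat_lamIota.2 ⟨b, (hψ b).sat hψb, (hφ b).sat hφb, fun c hc => ?_⟩
    rcases h.lamIota_ant_unique hm c b with hφc | hφb' | hcb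
    · exact ((hφ c).not_sat hφc hc).elim
    · exact (h.notMem_suc hφb hφb').elim
    · exact (heq c b).sat hcb
  · obtain ⟨b, hψb, hφb, huniq⟩ := hv.sat_lamIota.1 hs
    rcases h.lamIota_suc hm b with hφb' | hψb' | ⟨c, hφc, hcb⟩
    · exact (hφ b).not_sat hφb' hφb
    · exact (hψ b).not_sat hψb' hψb
    · exact (heq c b).not_sat hcb (huniq c ((hφ c).sat hφc))

theorem agreesAt_all2 (hv : v.NamesAll) {n : ℕ+} {X : ℕ} {φ : Formula L}
    (hφ : ∀ B, v.AgreesAt Γ Δ (φ.substRel n X B)) : v.AgreesAt Γ Δ (all2 n X φ) := by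
  refine ⟨fun hm => hv.sat_all2.2 fun B => (hφ B).sat (h.all2_ant hm B), fun hm hs => ?_⟩
  obtain ⟨B, hB⟩ := h.all2_suc hm
  exact (hφ B).not_sat hB (hv.sat_all2.1 hs B)

theorem agreesAt_ex2 (hv : v.NamesAll) {n : ℕ+} {X : ℕ} {φ : Formula L}
    (hφ : ∀ B, v.AgreesAt Γ Δ (φ.substRel n X B)) : v.AgreesAt Γ Δ (ex2 n X φ) := by
  refine ⟨fun hm => hv.sat_ex2.2 ((h.ex2_ant hm).imp fun B => (hφ B).sat), fun hm hs => ?_⟩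
  obtain ⟨B, hB⟩ := hv.sat_ex2.1 hs
  exact (hφ B).not_sat (h.ex2_suc hm B) hB

theorem agreesAt_lamIota2 (hv : v.NamesAll) {n : ℕ+} {X Y : ℕ} {ψ φ : Formula L}
    (hψ : ∀ B, v.AgreesAt Γ Δ (ψ.substRel n X B)) (hφ : ∀ B, v.AgreesAt Γ Δ (φ.substRel n Y B))
    (heq : ∀ A B : RelName L n, v.AgreesAt Γ Δ (relEq (.name A) (.name B))) :
    v.AgreesAt Γ Δ (lamIota2 n X ψ Y φ) := by
  refine ⟨fun hm => ?_, fun hm hs => ?_⟩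
  · obtain ⟨B, hφB, hψB⟩ := h.lamIota2_ant hm
    refine hv.sat_lamIota2.2 ⟨B, (hψ B).sat hψB, (hφ B).sat hφB, fun A hA => ?_⟩
    rcases h.lamIota2_ant_unique hm A B with hφA | hφB' | hAB
    · exact ((hφ A).not_sat hφA hA).elim
    · exact (h.notMem_suc hφB hφB').elim
    · exact (heq A B).sat hAB
  · obtain ⟨B, hψB, hφB, huniq⟩ := hv.sat_lamIota2.1 hs
    rcases h.lamIota2_suc hm B with hφB' | hψB' | ⟨A, hφA, hAB⟩
    · exact (hφ B).not_sat hφB' hφB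
    · exact (hψ B).not_sat hψB' hψB
    · exact (heq A B).not_sat hAB (huniq A ((hφ A).sat hφA))

theorem agreesAt (hv : v.NamesAll) (hat : ∀ χ : Formula L, χ.IsAtomic → v.AgreesAt Γ Δ χ) :
    ∀ φ : Formula L, v.AgreesAt Γ Δ φ
  | .eq .. | .pred .. | .relEq .. | .rel .. => hat _ trivial
  | .neg φ => h.agreesAt_neg (agreesAt hv hat φ)
  | .and φ ψ => h.agreesAt_and (agreesAt hv hat φ) (agreesAt hv hat ψ)
  | .or φ ψ => h.agreesAt_or (agreesAt hv hat φ) (agreesAt hv hat ψ)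
  | .imp φ ψ => h.agreesAt_imp (agreesAt hv hat φ) (agreesAt hv hat ψ)
  | .iff φ ψ => h.agreesAt_iff (agreesAt hv hat φ) (agreesAt hv hat ψ)
  | .all x φ => h.agreesAt_all hv fun b => agreesAt hv hat (φ.subst x b)
  | .ex x φ => h.agreesAt_ex hv fun b => agreesAt hv hat (φ.subst x b)
  | .lam x ψ _ => h.agreesAt_lam fun b => agreesAt hv hat (ψ.subst x b)
  | .lamIota x ψ y φ =>
      h.agreesAt_lamIota hv (fun b => agreesAt hv hat (ψ.subst x b))
        (fun b => agreesAt hv hat (φ.subst y b)) fun _ _ => hat _ trivial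
  | .all2 n X φ => h.agreesAt_all2 hv fun B => agreesAt hv hat (φ.substRel n X B)
  | .ex2 n X φ => h.agreesAt_ex2 hv fun B => agreesAt hv hat (φ.substRel n X B)
  | .lamIota2 n X ψ Y φ =>
      h.agreesAt_lamIota2 hv (fun B => agreesAt hv hat (ψ.substRel n X B))
        (fun B => agreesAt hv hat (φ.substRel n Y B)) fun _ _ => hat _ trivial
termination_by φ => φ.size
decreasing_by all_goals simp only [size, size_subst, size_substRel]; lia

end Saturated

/-! ### The term model -/

/-- An operation on `n`-tuples of terms whose values are atomic formulas with these terms as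
arguments, like `P(t₁, …, tₙ)` and `B(t₁, …, tₙ)`. -/
structure IsAtomicSchema {n : ℕ} (R : (Fin n → Term L) → Formula L) : Prop where
  isAtomic (ts : Fin n → Term L) : (R ts).IsAtomic
  subst (ts : Fin n → Term L) (x : ℕ) (b : Name L) :
    (R ts).subst x b = R fun i => (ts i).subst x b

theorem isAtomicSchema_pred {n : ℕ} (P : L.Pred n) : IsAtomicSchema (Formula.pred P) :=
  ⟨fun _ => trivial, fun _ _ _ => rfl⟩

theorem isAtomicSchema_rel {n : ℕ+} (B : RelName L n) :
    IsAtomicSchema (Formula.rel (.name B)) :=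
  ⟨fun _ => trivial, fun _ _ _ => rfl⟩

namespace Saturated

open Formula Assignment

variable {S : Set (Sequent L)} {C Γ Δ : Set (Formula L)}
  (h : Saturated S C (premiseFamilies L) Γ Δ)

include h in
theorem eq_symm {b c : Name L} (hbc : eq (.name b) (.name c) ∈ Γ) :
    eq (.name c) (.name b) ∈ Γ := by
  simpa [Formula.subst, Term.subst] using
    h.eq_subst (x := 0) (φ := eq (.var 0) (.name b)) trivial hbc
      (by simpa [Formula.subst, Term.subst] using h.eq_refl b)

include h in
theorem eq_trans {b c d : Name L} (hbc : eq (.name b) (.name c) ∈ Γ)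
    (hcd : eq (.name c) (.name d) ∈ Γ) : eq (.name b) (.name d) ∈ Γ := by
  simpa [Formula.subst, Term.subst] using
    h.eq_subst (x := 0) (φ := eq (.name b) (.var 0)) trivial hcd
      (by simpa [Formula.subst, Term.subst] using hbc)

include h in
theorem update_mem {n : ℕ} {R : (Fin n → Term L) → Formula L} (hR : IsAtomicSchema R)
    {b : Fin n → Name L} {i : Fin n} {c : Name L} (hb : (R fun j => .name (b j)) ∈ Γ)
    (hbc : eq (.name (b i)) (.name c) ∈ Γ) :
    (R fun j => .name (Function.update b i c j)) ∈ Γ := by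
  have instance_eq (d : Name L) :
      (R (Function.update (fun j => .name (b j)) i (.var 0))).subst 0 d =
        R fun j => .name (Function.update b i d j) := by
    rw [hR.subst]
    congr with j : 1
    obtain rfl | hj := eq_or_ne j i <;> simp [Term.subst, *]
  rw [← instance_eq]
  refine h.eq_subst (hR.isAtomic _) hbc ?_
  rwa [instance_eq, Function.update_eq_self]

include h in
theorem congr_names {n : ℕ} {R : (Fin n → Term L) → Formula L} (hR : IsAtomicSchema R)
    {b c : Fin n → Name L} (hbc : ∀ i, eq (.name (b i)) (.name (c i)) ∈ Γ)
    (hb : (R fun i => .name (b i)) ∈ Γ) : (R fun i => .name (c i)) ∈ Γ := by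
  have piecewise_mem (s : Finset (Fin n)) : (R fun i => .name (s.piecewise c b i)) ∈ Γ := by
    induction s using Finset.induction_on with
    | empty => simpa using hb
    | insert i s hi ih =>
        rw [Finset.piecewise_insert]
        exact h.update_mem hR ih (by simpa [hi] using hbc i)
  simpa using piecewise_mem Finset.univ

/-- Names are identified if their equality is in `Γ`. -/
def setoid : Setoid (Name L) where
  r b c := eq (.name b) (.name c) ∈ Γ
  iseqv := ⟨h.eq_refl, h.eq_symm, h.eq_trans⟩

/-- The individuals of the term model: names modulo the equalities in `Γ`. -/
abbrev Dom : Type := Quotient h.setoid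

/-- The individual denoted by a name. -/
def ind (b : Name L) : h.Dom := Quotient.mk h.setoid b

theorem ind_eq_ind {b c : Name L} : h.ind b = h.ind c ↔ eq (.name b) (.name c) ∈ Γ :=
  Quotient.eq

theorem ind_surjective : Function.Surjective h.ind := Quotient.mk_surjective

/-- The relation on the term model that holds of the individuals denoted by `b₁, …, bₙ` if
`R(b₁, …, bₙ) ∈ Γ`. -/
def asserted {n : ℕ} (R : (Fin n → Term L) → Formula L) : Set (Fin n → h.Dom) :=
  (fun b i => h.ind (b i)) '' {b : Fin n → Name L | (R fun i => .name (b i)) ∈ Γ}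

theorem mem_asserted {n : ℕ} {R : (Fin n → Term L) → Formula L} (hR : IsAtomicSchema R)
    (b : Fin n → Name L) :
    (fun i => h.ind (b i)) ∈ h.asserted R ↔ (R fun i => .name (b i)) ∈ Γ := by
  refine ⟨fun ⟨c, hc, hcb⟩ => ?_, fun hb => ⟨b, hb, rfl⟩⟩
  exact h.congr_names hR (fun i => h.ind_eq_ind.1 (congrFun hcb i)) hc

/-- The general model whose individuals are the names modulo the equalities in `Γ`, and whose
relations are those denoted by relational names. -/
def termModel : GeneralModel L where
  D := h.Dom
  con k := h.ind (.con k)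
  pred P := h.asserted (Formula.pred P)
  G n := Set.range fun B : RelName L n => h.asserted (Formula.rel (.name B))
  relCon K := ⟨_, .con K, rfl⟩

/-- The relation denoted by a relational name. -/
def relInd {n : ℕ+} (B : RelName L n) : h.termModel.G n := ⟨_, B, rfl⟩

theorem relInd_surjective (n : ℕ+) :
    Function.Surjective (h.relInd : RelName L n → h.termModel.G n) := by
  rintro ⟨_, B, rfl⟩
  exact ⟨B, rfl⟩

theorem mem_relInd {n : ℕ+} {B : RelName L n} (b : Fin n → Name L) :
    (fun i => h.ind (b i)) ∈ (h.relInd B).1 ↔ (rel (.name B) fun i => .name (b i)) ∈ Γ :=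
  h.mem_asserted (isAtomicSchema_rel B) b

theorem relInd_eq_relInd_iff {n : ℕ+} {A B : RelName L n} :
    h.relInd A = h.relInd B ↔ ∀ b : Fin n → Name L,
      (rel (.name A) fun i => .name (b i)) ∈ Γ ↔ (rel (.name B) fun i => .name (b i)) ∈ Γ := by
  simp only [Subtype.ext_iff, Set.ext_iff, ← mem_relInd h]
  exact h.ind_surjective.comp_left.forall

theorem relInd_eq_relInd {n : ℕ+} {A B : RelName L n}
    (hAB : relEq (.name A) (.name B) ∈ Γ) : h.relInd A = h.relInd B :=
  h.relInd_eq_relInd_iff.2 fun b => by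
    rcases h.relEq_ant hAB b with ⟨hA, hB⟩ | ⟨hA, hB⟩
    · exact iff_of_false (h.notMem_suc · hA) (h.notMem_suc · hB)
    · exact iff_of_true hA hB

theorem relInd_ne_relInd {n : ℕ+} {A B : RelName L n}
    (hAB : relEq (.name A) (.name B) ∈ Δ) : h.relInd A ≠ h.relInd B := fun e => by
  obtain ⟨b, ⟨hA, hB⟩ | ⟨hB, hA⟩⟩ := h.relEq_suc hAB
  · exact h.notMem_suc ((h.relInd_eq_relInd_iff.1 e b).1 hA) hB
  · exact h.notMem_suc ((h.relInd_eq_relInd_iff.1 e b).2 hB) hA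

/-- The assignment evaluates every parameter as the individual or relation it denotes. -/
structure IsCanonical (v : Assignment h.termModel) : Prop where
  par (a : ℕ) : v.par a = h.ind (.par a)
  relPar (n : ℕ+) (A : ℕ) : v.relPar n A = h.relInd (.par A)

namespace IsCanonical

variable {h} {v : Assignment h.termModel} (hv : h.IsCanonical v)

include hv

theorem term_name (b : Name L) : v.term (.name b) = h.ind b := by
  cases b with
  | par a => exact hv.par a
  | con k => rfl

theorem relTerm_name {n : ℕ+} (B : RelName L n) : v.relTerm (.name B) = h.relInd B := by
  cases B with
  | par A => exact hv.relPar n A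
  | con K => rfl

theorem namesAll : v.NamesAll where
  name_surjective := by
    rw [funext hv.term_name]
    exact h.ind_surjective
  relName_surjective n := by
    rw [funext hv.relTerm_name]
    exact h.relInd_surjective n

theorem agreesAt_eq (b c : Name L) : v.AgreesAt Γ Δ (eq (.name b) (.name c)) := by
  have hsat : Sat h.termModel v (eq (.name b) (.name c)) ↔ eq (.name b) (.name c) ∈ Γ := by
    simp only [Sat, hv.term_name]
    exact h.ind_eq_ind
  exact ⟨hsat.2, fun hm hs => h.notMem_suc (hsat.1 hs) hm⟩

theorem agreesAt_pred {n : ℕ} (P : L.Pred n) (b : Fin n → Name L) :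
    v.AgreesAt Γ Δ (pred P fun i => .name (b i)) := by
  have hsat : Sat h.termModel v (pred P fun i => .name (b i)) ↔
      (pred P fun i => .name (b i)) ∈ Γ := by
    simp only [Sat, hv.term_name]
    exact h.mem_asserted (isAtomicSchema_pred P) b
  exact ⟨hsat.2, fun hm hs => h.notMem_suc (hsat.1 hs) hm⟩

theorem agreesAt_rel {n : ℕ+} (B : RelName L n) (b : Fin n → Name L) :
    v.AgreesAt Γ Δ (rel (.name B) fun i => .name (b i)) := by
  have hsat : Sat h.termModel v (rel (.name B) fun i => .name (b i)) ↔
      (rel (.name B) fun i => .name (b i)) ∈ Γ := by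
    simp only [Sat, hv.term_name, hv.relTerm_name]
    exact h.mem_relInd b
  exact ⟨hsat.2, fun hm hs => h.notMem_suc (hsat.1 hs) hm⟩

theorem agreesAt_relEq {n : ℕ+} (A B : RelName L n) :
    v.AgreesAt Γ Δ (relEq (.name A) (.name B)) := by
  constructor <;> simp only [Sat, hv.relTerm_name]
  exacts [h.relInd_eq_relInd, h.relInd_ne_relInd]

theorem agreesAt_of_isAtomic (φ : Formula L) (hφ : φ.IsAtomic) : v.AgreesAt Γ Δ φ := by
  refine h.agreesAt_of_closed fun hc => ?_
  cases φ with
  | eq t s =>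
      obtain ⟨b, rfl⟩ := Term.exists_name_of_forall_not_hasVar fun z hz => hc.1 z (.inl hz)
      obtain ⟨c, rfl⟩ := Term.exists_name_of_forall_not_hasVar fun z hz => hc.1 z (.inr hz)
      exact hv.agreesAt_eq b c
  | pred P ts =>
      choose b hb using fun i =>
        Term.exists_name_of_forall_not_hasVar fun z hz => hc.1 z ⟨i, hz⟩
      obtain rfl := funext hb
      exact hv.agreesAt_pred P b
  | relEq U V =>
      obtain ⟨A, rfl⟩ := RelTerm.exists_name_of_forall_not_hasVar
        fun m Z hz => hc.2 m Z (.inl hz)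
      obtain ⟨B, rfl⟩ := RelTerm.exists_name_of_forall_not_hasVar
        fun m Z hz => hc.2 m Z (.inr hz)
      exact hv.agreesAt_relEq A B
  | rel U ts =>
      obtain ⟨B, rfl⟩ := RelTerm.exists_name_of_forall_not_hasVar fun m Z hz => hc.2 m Z hz
      choose b hb using fun i =>
        Term.exists_name_of_forall_not_hasVar fun z hz => hc.1 z ⟨i, hz⟩
      obtain rfl := funext hb
      exact hv.agreesAt_rel B b
  | _ => exact hφ.elim

theorem agreesAt (φ : Formula L) : v.AgreesAt Γ Δ φ :=
  h.agreesAt hv.namesAll hv.agreesAt_of_isAtomic φ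

theorem holds_of_mem {s : Sequent L} (hs : s ∈ S) (hsc : s.Closed)
    (hC : ∀ φ, s.Has φ → φ ∈ C) : s.Holds h.termModel v := by
  intro hant
  rcases h.exists_mem_of_hyp hs hsc hC with ⟨φ, hφ, hφΔ⟩ | ⟨φ, hφ, hφΓ⟩
  · exact ((hv.agreesAt φ).not_sat hφΔ (hant φ hφ)).elim
  · exact ⟨φ, hφ, (hv.agreesAt φ).sat hφΓ⟩

theorem not_holds_of_within {H : Sequent L} (hH : H.Within Γ Δ) :
    ¬ H.Holds h.termModel v := fun hholds => by
  obtain ⟨ψ, hψ, hs⟩ := hholds fun φ hφ => (hv.agreesAt φ).sat (hH.1 φ hφ)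
  exact (hv.agreesAt ψ).not_sat (hH.2 ψ hψ) hs

end IsCanonical

/-- The canonical assignment with the given values of the variables. -/
def canonical (f : ℕ → h.termModel.D) (g : (n : ℕ+) → ℕ → h.termModel.G n) :
    Assignment h.termModel where
  var := f
  par a := h.ind (.par a)
  relVar := g
  relPar _ A := h.relInd (.par A)

theorem isCanonical_canonical (f : ℕ → h.termModel.D)
    (g : (n : ℕ+) → ℕ → h.termModel.G n) : h.IsCanonical (h.canonical f g) :=
  ⟨fun _ => rfl, fun _ _ => rfl⟩

theorem exists_canonical_comp (v : Assignment h.termModel) :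
    ∃ (σ : ParSubst L) (u : Assignment h.termModel), h.IsCanonical u ∧ u.comp σ = v := by
  choose σ hσ using fun a => h.ind_surjective (v.par a)
  choose τ hτ using fun n A => h.relInd_surjective n (v.relPar n A)
  have hu := h.isCanonical_canonical v.var v.relVar
  refine ⟨⟨σ, τ⟩, _, hu, ?_⟩
  simp only [Assignment.comp, hu.term_name, hu.relTerm_name, hσ, hτ]
  rfl

end Saturated

end RLL

theorem mainTheorem1 (L : RLL.Signature) [Countable L.Con] [∀ n, Countable (L.Pred n)]
    [∀ n, Countable (L.RelCon n)] (S : Set (RLL.Sequent L)) (H : RLL.Sequent L)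
    (hS : ∀ s ∈ S, s.Closed) (hH : H.Closed) :
    (RLL.Entails S H → RLL.DerivableCF S H) ∧
    (RLL.SubstClosed S → RLL.EntailsGlobally S H → RLL.DerivableCF S H) := by
  refine ⟨fun hE => ?_, fun hsub hE => ?_⟩
  all_goals
    by_contra hd
    obtain ⟨Γ, Δ, hw, h⟩ := RLL.exists_saturated RLL.countable_premiseFamilies hH hd
    have hv := h.isCanonical_canonical (fun _ => h.ind (.par 0)) fun _ _ => h.relInd (.par 0)
    refine hv.not_holds_of_within hw ?_
  · exact hE h.termModel _ fun s hs => hv.holds_of_mem hs (hS s hs) fun φ hφ => ⟨s, hs, hφ⟩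
  · refine hE h.termModel (fun s hs v => ?_) _
    obtain ⟨σ, u, hu, rfl⟩ := h.exists_canonical_comp v
    have hσ : s.parSubst σ ∈ S := hsub s hs σ
    exact (RLL.Sequent.holds_parSubst σ s u).1
      (hu.holds_of_mem hσ (hS _ hσ) fun φ hφ => ⟨_, hσ, hφ⟩)
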